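/- For real $d\times d$ matrices let $\langle A,B\rangle=\operatorname{tr}(A^{\top}B)$, let $\|A\|_\sigma$ be the spectral norm (largest singular value) and $\|A\|_\Sigma$ the trace norm (sum of the singular values). Consider the following game with horizon $n\ge 1$ and dimension $d\ge 2$, both known to the learner. In each round $t=1,\dots,n$, the learner, knowing $Y_1,\dots,Y_{t-1}$, uses fresh random bits to choose a positive semidefinite matrix $W_t\in\mathbb R^{d\times d}$; nature, knowing the learner's algorithm and $W_1,\dots,W_{t-1}$ but not the random bits of round $t$, chooses a matrix $Y_t\in\mathbb R^{d\times d}$ with $\|Y_t\|_\sigma\le 1$; the learner incurs the loss $\langle W_t,Y_t\rangle$ and observes $Y_t$. There are a single randomized algorithm for the learner and a universal constant $C>0$ such that, for all $n\ge 1$ and $d\ge 2$: 1. (efficiency) in each round the algorithm uses at most polynomially many (in $n$ and $d$) elementary steps of a random access machine over the reals, with exact unit-cost arithmetic operations $+,-,\times,/$ and comparisons on real numbers, unit-cost addition, truncated subtraction and multiplication of natural numbers for counting and indexing, and fair coin flips; 2. (regret) against every such (possibly adaptive) strategy of nature, $$\mathbb E\Big[\sum_{t=1}^n\langle W_t,Y_t\rangle-\sum_{t=1}^n\langle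 W,Y_t\rangle\Big]\le C\,(\|W\|_\Sigma+1)\sqrt{n\,\log d\,\log\big((\|W\|_\Sigma+1)n\big)}\qquad\text{for all } W\succeq 0,\ W\in\mathbb R^{d\times d},$$ where the expectation is over the learner's random bits. -/

import Mathlib

noncomputable section

namespace OnlineMatrix

/-! ### A randomized real-number machine with unit-cost arithmetic

Programs work with natural-number variables (used for counting and indexing), with arrays of real
numbers of three indices, and with independent fair coin flips.  Real registers allow exactly
`+`, `-`, `*`, `/` and comparison; there are no roots, exponentials, logarithms, rounding, or
matrix operations, and the only constants are natural numbers.  There is no way to pass from a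
real to a natural number except by branching on comparisons.  All loops have a bound that is
computed before they start, so every program halts; loops of length polynomial in the input are
enough to run any polynomial-time program. -/

/-- Natural-number expressions. -/
inductive NExp : Type
  | const (n : ℕ) : NExp
  | var (x : ℕ) : NExp
  | add (e₁ e₂ : NExp) : NExp
  | sub (e₁ e₂ : NExp) : NExp
  | mul (e₁ e₂ : NExp) : NExp

/-- Real expressions; `load a i j k` reads the entry `(i, j, k)` of the array `a`. -/
inductive RExp : Type
  | ofNat (e : NExp) : RExp
  | load (a : ℕ) (i j k : NExp) : RExp
  | add (e₁ e₂ : RExp) : RExp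
  | sub (e₁ e₂ : RExp) : RExp
  | mul (e₁ e₂ : RExp) : RExp
  | div (e₁ e₂ : RExp) : RExp

/-- Comparisons. -/
inductive Test : Type
  | natLe (e₁ e₂ : NExp) : Test
  | realLe (e₁ e₂ : RExp) : Test

/-- Programs.  `flip x` puts a fresh fair random bit into the variable `x`; `loop x e body` runs
`body` for `x = 0, 1, …, m - 1`, where `m` is the value of `e` at the start of the loop. -/
inductive Prog : Type
  | skip : Prog
  | setNat (x : ℕ) (e : NExp) : Prog
  | store (a : ℕ) (i j k : NExp) (e : RExp) : Prog
  | flip (x : ℕ) : Prog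
  | seq (p q : Prog) : Prog
  | ite (b : Test) (p q : Prog) : Prog
  | loop (x : ℕ) (e : NExp) (body : Prog) : Prog

/-- The state of the machine: variables, real arrays, the coins not yet flipped, and the number of
elementary steps made so far. -/
structure State : Type where
  nat : ℕ → ℕ
  real : ℕ → ℕ → ℕ → ℕ → ℝ
  coins : ℕ → Bool
  time : ℕ

/-- Value of a natural-number expression (subtraction is truncated). -/
def NExp.eval (v : ℕ → ℕ) : NExp → ℕ
  | .const n => n
  | .var x => v x
  | .add e₁ e₂ => e₁.eval v + e₂.eval v
  | .sub e₁ e₂ => e₁.eval v - e₂.eval v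
  | .mul e₁ e₂ => e₁.eval v * e₂.eval v

/-- Number of elementary operations in a natural-number expression. -/
def NExp.cost : NExp → ℕ
  | .const _ => 1
  | .var _ => 1
  | .add e₁ e₂ => e₁.cost + e₂.cost + 1
  | .sub e₁ e₂ => e₁.cost + e₂.cost + 1
  | .mul e₁ e₂ => e₁.cost + e₂.cost + 1

/-- Value of a real expression (division by `0` returns `0`). -/
def RExp.eval (v : ℕ → ℕ) (m : ℕ → ℕ → ℕ → ℕ → ℝ) : RExp → ℝ
  | .ofNat e => (e.eval v : ℝ)
  | .load a i j k => m a (i.eval v) (j.eval v) (k.eval v)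
  | .add e₁ e₂ => e₁.eval v m + e₂.eval v m
  | .sub e₁ e₂ => e₁.eval v m - e₂.eval v m
  | .mul e₁ e₂ => e₁.eval v m * e₂.eval v m
  | .div e₁ e₂ => e₁.eval v m / e₂.eval v m

/-- Number of elementary operations in a real expression. -/
def RExp.cost : RExp → ℕ
  | .ofNat e => e.cost + 1
  | .load _ i j k => i.cost + j.cost + k.cost + 1
  | .add e₁ e₂ => e₁.cost + e₂.cost + 1
  | .sub e₁ e₂ => e₁.cost + e₂.cost + 1
  | .mul e₁ e₂ => e₁.cost + e₂.cost + 1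
  | .div e₁ e₂ => e₁.cost + e₂.cost + 1

/-- Truth of a comparison. -/
def Test.Holds (s : State) : Test → Prop
  | .natLe e₁ e₂ => e₁.eval s.nat ≤ e₂.eval s.nat
  | .realLe e₁ e₂ => e₁.eval s.nat s.real ≤ e₂.eval s.nat s.real

/-- Number of elementary operations in a comparison. -/
def Test.cost : Test → ℕ
  | .natLe e₁ e₂ => e₁.cost + e₂.cost + 1
  | .realLe e₁ e₂ => e₁.cost + e₂.cost + 1

/-- Let `k` units of time pass. -/
def State.tick (s : State) (k : ℕ) : State := { s with time := s.time + k }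

/-- Write `n` into the variable `x`. -/
def State.setNat (s : State) (x n : ℕ) : State :=
  { s with nat := Function.update s.nat x n }

/-- Write `r` into the entry `(i, j, k)` of the array `a`. -/
def State.setReal (s : State) (a i j k : ℕ) (r : ℝ) : State :=
  { s with real := fun a' i' j' k' =>
      if a' = a ∧ i' = i ∧ j' = j ∧ k' = k then r else s.real a' i' j' k' }

/-- Flip the next coin and write the outcome (`0` or `1`) into the variable `x`. -/
def State.flip (s : State) (x : ℕ) : State :=
  { s.setNat x (s.coins 0).toNat with coins := fun i => s.coins (i + 1) }

open Classical in
/-- Run a program, counting every elementary operation, write, coin flip, branch and loop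
iteration. -/
def Prog.exec : Prog → State → State
  | .skip, s => s.tick 1
  | .setNat x e, s => (s.setNat x (e.eval s.nat)).tick (e.cost + 1)
  | .store a i j k e, s =>
      (s.setReal a (i.eval s.nat) (j.eval s.nat) (k.eval s.nat) (e.eval s.nat s.real)).tick
        (i.cost + j.cost + k.cost + e.cost + 1)
  | .flip x, s => (s.flip x).tick 1
  | .seq p q, s => q.exec (p.exec s)
  | .ite b p q, s =>
      if b.Holds s then p.exec (s.tick (b.cost + 1)) else q.exec (s.tick (b.cost + 1))
  | .loop x e body, s =>
      (List.range (e.eval s.nat)).foldl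
        (fun s' i => body.exec ((s'.setNat x i).tick 1)) (s.tick (e.cost + 1))

/-! ### Matrices -/

/-- Real `d × d` matrices. -/
abbrev Mat (d : ℕ) : Type := Matrix (Fin d) (Fin d) ℝ

/-- The inner product `⟨A, B⟩ = tr (Aᵀ B) = ∑ i j, A i j * B i j`. -/
def matInner {d : ℕ} (A B : Mat d) : ℝ := (A.transpose * B).trace

/-- The spectral norm: the operator norm with respect to the Euclidean norm. -/
def specNorm {d : ℕ} (A : Mat d) : ℝ := ‖Matrix.toEuclideanCLM (n := Fin d) (𝕜 := ℝ) A‖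

/-- The trace norm: the sum of the singular values. -/
def traceNorm {d : ℕ} (A : Mat d) : ℝ :=
  ∑ i ∈ Finset.range d, (Matrix.toEuclideanLin A).singularValues i

/-! ### Matrix prediction strategies computed by programs -/

/-- Initial state in the round that follows the losses `Ys`: the variables `0`, `1`, `2` hold the
horizon `n`, the dimension `d` and the number of past rounds; the array `0` holds the entries
of the past loss matrices; everything else is `0`. -/
def initState (n : ℕ) {d : ℕ} (Ys : List (Mat d)) (coins : ℕ → Bool) : State where
  nat := fun x => if x = 0 then n else if x = 1 then d else if x = 2 then Ys.length else 0
  real := fun a s i j =>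
    if h : a = 0 ∧ i < d ∧ j < d then Ys.getD s 0 ⟨i, h.2.1⟩ ⟨j, h.2.2⟩ else 0
  coins := coins
  time := 0

/-- The matrix that the program plays after the losses `Ys`, read off from the array `1`. -/
def predict (P : Prog) (n : ℕ) {d : ℕ} (Ys : List (Mat d)) (coins : ℕ → Bool) : Mat d :=
  fun i j => (P.exec (initState n Ys coins)).real 1 0 i j

/-- The number of steps that the program makes in the round after the losses `Ys`. -/
def steps (P : Prog) (n : ℕ) {d : ℕ} (Ys : List (Mat d)) (coins : ℕ → Bool) : ℕ :=
  (P.exec (initState n Ys coins)).time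

/-- The first `t` rounds of the game between the program, which in round `s` (counted from `0`)
flips the coins `ω s`, and nature, which picks each loss matrix knowing all the matrices played in
earlier rounds: the list of plays and the list of losses, both in order of time. -/
def transcript (P : Prog) (n : ℕ) {d : ℕ} (nature : List (Mat d) → Mat d) (ω : ℕ → ℕ → Bool) :
    ℕ → List (Mat d) × List (Mat d)
  | 0 => ([], [])
  | t + 1 =>
    let h := transcript P n nature ω t
    (h.1 ++ [predict P n h.2 (ω t)], h.2 ++ [nature h.1])

/-- The matrix played in round `t` (counted from `0`). -/
def play (P : Prog) (n : ℕ) {d : ℕ} (nature : List (Mat d) → Mat d) (ω : ℕ → ℕ → Bool) (t : ℕ) :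
    Mat d :=
  predict P n (transcript P n nature ω t).2 (ω t)

/-- The loss matrix of round `t` (counted from `0`). -/
def loss (P : Prog) (n : ℕ) {d : ℕ} (nature : List (Mat d) → Mat d) (ω : ℕ → ℕ → Bool) (t : ℕ) :
    Mat d :=
  nature (transcript P n nature ω t).1

/-- The regret to the comparator `W` after `n` rounds. -/
def regret (P : Prog) (n : ℕ) {d : ℕ} (nature : List (Mat d) → Mat d) (W : Mat d)
    (ω : ℕ → ℕ → Bool) : ℝ :=
  ∑ t ∈ Finset.range n, matInner (play P n nature ω t) (loss P n nature ω t) -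
    ∑ t ∈ Finset.range n, matInner W (loss P n nature ω t)

/-- The law of an infinite sequence of independent fair coins for each round, all independent. -/
def coinLaw : MeasureTheory.Measure (ℕ → ℕ → Bool) :=
  MeasureTheory.Measure.infinitePi fun _ : ℕ =>
    MeasureTheory.Measure.infinitePi fun _ : ℕ => (PMF.uniformOfFintype Bool).toMeasure

end OnlineMatrix

end

/-!
A deterministic strategy suffices, so the regret does not depend on the coins and its expectation
is its value on one game.

Only the symmetric parts `H t` of the losses matter, since the plays and the comparator are
symmetric. Let `S t` be the sum of `H 0, …, H (t - 1)`. If matrix exponentials were available, the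
strategy could bet, for each rate `β` in a grid, a multiple of `exp (-β S)`: the Golden–Thompson
inequality makes the potential `tr exp (-β S)` (suitably discounted) drop by the loss of this bet.
The machine only has field operations, so the exponential is replaced by the power
`(1 - β / (n + 2) • S) ^ (n + 2)`, which is computed exactly, and the bet is its gradient, a power
with exponent `n + 1`. All powers have a base `⪰ 1/2`, so every play is positive semidefinite.

The analogue of the Golden–Thompson step is `potential_step`. Convexity of the trace of a power gives
a first-order bound with the gradient at the new matrix; the difference of the gradients telescopes
into traces `tr (A' ^ j H A ^ m H)`, which in eigenbases of `A'` and `A` are bounded by the weighted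
arithmetic-geometric mean inequality (`trace_mixed_le`). The error is a factor
`(1 + 2 β²) / (1 - 2 β²)` per round, which is discounted in the weights of the strategy.

Summing over rounds and rates (`strategy_loss_le`), the total loss is at most `1` minus the final
potentials. If `G` is the largest eigenvalue of `-S n`, the comparator `W` gains at most
`tr W * G ≤ traceNorm W * G`, while the potential for `β ≈ G / (14 n)` is at least
`exp (G² / (56 n))` (`exp_le_final_potential`, `exists_good_rate`). Hence the regret is at most
`1 + w G - exp (G² / (56 n)) / (2 n d)` with `w = traceNorm W`, and maximizing over `G` gives the
bound (`regret_optimization`). For `n = 1` the bound vanishes at `W = 0`, which forces the play to be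
zero; the factor `n - 1` in the weights sees to this.

The program that computes the strategy is analysed with two loop rules, `exec_accumulate` for sums
and `exec_forEntries` for filling a matrix. Its running time is polynomial because every loop has at
most `n + d` iterations and the nesting depth is fixed (`exec_time_le`, `exists_timeBound_le`).
-/

namespace OnlineMatrix

open Matrix

/-! ### Trace inequalities for powers of symmetric matrices -/

section Trace

variable {ι : Type*} [Fintype ι] [DecidableEq ι]

/-- A real symmetric matrix with `A ⪰ c` is orthogonally diagonalizable with all eigenvalues at
least `c`. -/
theorem exists_diagonalization {A : Matrix ι ι ℝ} {c : ℝ}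
    (hA : (A - c • (1 : Matrix ι ι ℝ)).PosSemidef) :
    ∃ (U : Matrix ι ι ℝ) (a : ι → ℝ), Uᵀ * U = 1 ∧ U * Uᵀ = 1 ∧ (∀ i, c ≤ a i) ∧
      A = U * diagonal a * Uᵀ := by
  have hs := hA.isHermitian.spectral_theorem
  rw [Unitary.conjStarAlgAut_apply] at hs
  set U : Matrix ι ι ℝ := (hA.isHermitian.eigenvectorUnitary : Matrix ι ι ℝ) with hU
  have h1 : Uᵀ * U = 1 := by
    have := Unitary.coe_star_mul_self hA.isHermitian.eigenvectorUnitary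
    simpa [star_eq_conjTranspose, conjTranspose_eq_transpose_of_trivial] using this
  have h2 : U * Uᵀ = 1 := mul_eq_one_comm.mp h1
  refine ⟨U, fun i => hA.isHermitian.eigenvalues i + c, h1, h2, fun i => ?_, ?_⟩
  · have := hA.eigenvalues_nonneg i
    linarith
  · have e : diagonal (fun i => hA.isHermitian.eigenvalues i + c)
        = diagonal hA.isHermitian.eigenvalues + c • (1 : Matrix ι ι ℝ) := by
      ext i j
      by_cases h : i = j
      · subst h; simp
      · simp [h]
    rw [e, mul_add, add_mul, mul_smul_comm, smul_mul_assoc, mul_one, h2, ← sub_eq_iff_eq_add]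
    exact hs

theorem pow_conj_diagonal {U : Matrix ι ι ℝ} (hU : Uᵀ * U = 1) (hU' : U * Uᵀ = 1) (a : ι → ℝ)
    (k : ℕ) : (U * diagonal a * Uᵀ) ^ k = U * diagonal (fun i => a i ^ k) * Uᵀ := by
  induction k with
  | zero => simp [hU']
  | succ k ih =>
    rw [pow_succ, ih]
    calc U * diagonal (fun i => a i ^ k) * Uᵀ * (U * diagonal a * Uᵀ)
        = U * diagonal (fun i => a i ^ k) * (Uᵀ * U) * diagonal a * Uᵀ := by
          simp only [Matrix.mul_assoc]
      _ = U * diagonal (fun i => a i ^ (k + 1)) * Uᵀ := by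
          rw [hU, Matrix.mul_one, Matrix.mul_assoc U, diagonal_mul_diagonal]
          simp only [pow_succ]

theorem exists_trace_pow {A : Matrix ι ι ℝ} {c : ℝ}
    (hA : (A - c • (1 : Matrix ι ι ℝ)).PosSemidef) :
    ∃ a : ι → ℝ, (∀ i, c ≤ a i) ∧ ∀ k : ℕ, (A ^ k).trace = ∑ i, a i ^ k := by
  obtain ⟨U, a, h1, h2, ha, rfl⟩ := exists_diagonalization hA
  refine ⟨a, ha, fun k => ?_⟩
  rw [pow_conj_diagonal h1 h2, trace_mul_comm, ← Matrix.mul_assoc, h1, Matrix.one_mul,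
    trace_diagonal]

/-- In eigenbases of `A` and `B`, a mixed trace is a sum of products of powers of eigenvalues with
nonnegative weights that do not depend on the exponents. Inequalities between monomials in two
nonnegative reals therefore carry over to mixed traces. -/
theorem exists_trace_mixed {A B : Matrix ι ι ℝ} (hA : A.PosSemidef) (hB : B.PosSemidef)
    (D : Matrix ι ι ℝ) :
    ∃ (a b : ι → ℝ) (c : ι → ι → ℝ), (∀ i, 0 ≤ a i) ∧ (∀ i, 0 ≤ b i) ∧ (∀ i j, 0 ≤ c i j) ∧
      ∀ j m : ℕ, (Dᵀ * A ^ j * D * B ^ m).trace = ∑ i, ∑ k, c i k * (a i ^ j * b k ^ m) := by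
  obtain ⟨U, a, hU, hU', ha, rfl⟩ := exists_diagonalization (A := A) (c := 0) (by simpa using hA)
  obtain ⟨V, b, hV, hV', hb, rfl⟩ := exists_diagonalization (A := B) (c := 0) (by simpa using hB)
  set M := Uᵀ * D * V with hM
  refine ⟨a, b, fun i k => M i k ^ 2, ha, hb, fun i j => sq_nonneg _, fun j m => ?_⟩
  rw [pow_conj_diagonal hU hU', pow_conj_diagonal hV hV']
  have : (Dᵀ * (U * diagonal (fun i => a i ^ j) * Uᵀ) * D * (V * diagonal (fun i => b i ^ m) * Vᵀ))
      = (Dᵀ * U * diagonal (fun i => a i ^ j) * M * diagonal (fun i => b i ^ m)) * Vᵀ := by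
    simp only [hM, Matrix.mul_assoc]
  rw [this, trace_mul_comm]
  have : Vᵀ * (Dᵀ * U * diagonal (fun i => a i ^ j) * M * diagonal (fun i => b i ^ m))
      = Mᵀ * diagonal (fun i => a i ^ j) * (M * diagonal (fun i => b i ^ m)) := by
    simp only [hM, transpose_mul, transpose_transpose, Matrix.mul_assoc]
  rw [this, trace, Finset.sum_comm]
  refine Finset.sum_congr rfl fun k _ => ?_
  rw [diag_apply, mul_apply]
  refine Finset.sum_congr rfl fun i _ => ?_
  rw [mul_diagonal, mul_diagonal, transpose_apply]
  ring

/-- Weighted arithmetic-geometric mean inequality with natural weights. -/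
theorem weighted_amgm_pow {x y : ℝ} (hx : 0 ≤ x) (hy : 0 ≤ y) (j m : ℕ) :
    ((j : ℝ) + m) * (x ^ j * y ^ m) ≤ j * x ^ (j + m) + m * y ^ (j + m) := by
  rcases Nat.eq_zero_or_pos (j + m) with h | h
  · obtain ⟨rfl, rfl⟩ : j = 0 ∧ m = 0 := by omega
    simp
  have hq : (0 : ℝ) < (j : ℝ) + m := by exact_mod_cast h
  have key := Real.geom_mean_le_arith_mean2_weighted (w₁ := j / ((j : ℝ) + m))
    (w₂ := m / ((j : ℝ) + m)) (p₁ := x ^ (j + m)) (p₂ := y ^ (j + m)) (by positivity)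
    (by positivity) (by positivity) (by positivity) (by field_simp)
  have e : ∀ z : ℝ, 0 ≤ z → ∀ l : ℕ, (z ^ (j + m)) ^ ((l : ℝ) / ((j : ℝ) + m)) = z ^ l := by
    intro z hz l
    rw [← Real.rpow_natCast z (j + m), ← Real.rpow_mul hz]
    push_cast
    rw [mul_div_cancel₀ _ hq.ne', Real.rpow_natCast]
  rw [e x hx, e y hy] at key
  calc ((j : ℝ) + m) * (x ^ j * y ^ m) ≤ ((j : ℝ) + m) *
        (j / ((j : ℝ) + m) * x ^ (j + m) + m / ((j : ℝ) + m) * y ^ (j + m)) := by gcongr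
    _ = _ := by field_simp

theorem trace_mixed_le {A B : Matrix ι ι ℝ} (hA : A.PosSemidef) (hB : B.PosSemidef)
    (D : Matrix ι ι ℝ) (j m : ℕ) :
    ((j : ℝ) + m) * (Dᵀ * A ^ j * D * B ^ m).trace ≤
      j * (Dᵀ * A ^ (j + m) * D).trace + m * (Dᵀ * D * B ^ (j + m)).trace := by
  obtain ⟨a, b, c, ha, hb, hc, h⟩ := exists_trace_mixed hA hB D
  have h1 := h (j + m) 0
  have h2 := h 0 (j + m)
  simp only [pow_zero, mul_one, one_mul] at h1 h2
  rw [h, h1, h2]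
  simp only [Finset.mul_sum, ← Finset.sum_add_distrib]
  refine Finset.sum_le_sum fun i _ => Finset.sum_le_sum fun k _ => ?_
  have := mul_le_mul_of_nonneg_left (weighted_amgm_pow (ha i) (hb k) j m) (hc i k)
  linarith

theorem trace_mul_nonneg_of_posSemidef {A B : Matrix ι ι ℝ} (hA : A.PosSemidef)
    (hB : B.PosSemidef) : 0 ≤ (A * B).trace := by
  obtain ⟨a, b, c, ha, hb, hc, h⟩ := exists_trace_mixed hA hB 1
  have h1 := h 1 1
  simp only [transpose_one, Matrix.one_mul, Matrix.mul_one, pow_one] at h1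
  rw [h1]
  exact Finset.sum_nonneg fun i _ => Finset.sum_nonneg fun k _ =>
    mul_nonneg (hc i k) (mul_nonneg (ha i) (hb k))

theorem pow_succ_sub_pow_succ (A B : Matrix ι ι ℝ) (q : ℕ) :
    A ^ (q + 1) - B ^ (q + 1) =
      ∑ j ∈ Finset.range (q + 1), B ^ j * (A - B) * A ^ (q - j) := by
  have h := Finset.sum_range_sub' (fun j => B ^ j * A ^ (q + 1 - j)) (q + 1)
  simp only [pow_zero, Matrix.one_mul, Nat.sub_zero, Nat.sub_self, Matrix.mul_one] at h
  rw [← h]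
  refine Finset.sum_congr rfl fun j hj => ?_
  have hj' : j ≤ q := by simpa [Nat.lt_succ_iff] using hj
  rw [show q + 1 - j = (q - j) + 1 by omega, show q + 1 - (j + 1) = q - j by omega, pow_succ' A,
    pow_succ B]
  noncomm_ring

theorem trace_pow_le_four_mul {A : Matrix ι ι ℝ}
    (hA : (A - (1 / 2 : ℝ) • (1 : Matrix ι ι ℝ)).PosSemidef) (q : ℕ) :
    (A ^ q).trace ≤ 4 * (A ^ (q + 2)).trace := by
  obtain ⟨a, ha, h⟩ := exists_trace_pow hA
  rw [h, h, Finset.mul_sum]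
  refine Finset.sum_le_sum fun i _ => ?_
  have h0 : (0 : ℝ) ≤ a i ^ q := pow_nonneg (by linarith [ha i]) _
  rw [pow_add]
  nlinarith [ha i, mul_nonneg h0 (show (0 : ℝ) ≤ 4 * a i ^ 2 - 1 by nlinarith [ha i])]

omit [Fintype ι] in
theorem posSemidef_of_sub_smul_one {A : Matrix ι ι ℝ} {c : ℝ} (hc : 0 ≤ c)
    (hA : (A - c • (1 : Matrix ι ι ℝ)).PosSemidef) : A.PosSemidef := by
  have := hA.add (PosSemidef.one.smul hc)
  simpa using this

/-- One step of the potential argument: the trace of a high power of `A` changes by at most its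
first-order term, evaluated at the *old* matrix, up to a factor `1 ± 2 β²` with `β = b (q + 2)`.
Convexity of the trace of a power gives the first-order term at the new matrix `A - b H`; moving
it to the old one costs the mixed traces bounded by `trace_mixed_le`. -/
theorem potential_step {A H : Matrix ι ι ℝ} {b : ℝ} (hb : 0 ≤ b) {q : ℕ} (hq : 1 ≤ q)
    (hA : (A - (1 / 2 : ℝ) • (1 : Matrix ι ι ℝ)).PosSemidef)
    (hA' : (A - b • H - (1 / 2 : ℝ) • (1 : Matrix ι ι ℝ)).PosSemidef)
    (hH : Hᵀ = H) (hH1 : (1 - H * H).PosSemidef) :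
    (1 - 2 * (b * (q + 2)) ^ 2) * ((A - b • H) ^ (q + 2)).trace ≤
      (1 + 2 * (b * (q + 2)) ^ 2) * (A ^ (q + 2)).trace
        - b * (q + 2) * (A ^ (q + 1) * H).trace := by
  set A' := A - b • H with hA'def
  have pA : A.PosSemidef := posSemidef_of_sub_smul_one (by norm_num) hA
  have pA' : A'.PosSemidef := posSemidef_of_sub_smul_one (by norm_num) hA'
  have hAA : A = A' + b • H := by simp [hA'def]
  -- convexity of the trace of a power, with the gradient at `A'`
  have klein : (A' ^ (q + 2)).trace ≤
      (A ^ (q + 2)).trace - b * (q + 2) * (A' ^ (q + 1) * H).trace := by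
    have h := trace_mixed_le pA' pA 1 (q + 1) 1
    simp only [transpose_one, Matrix.one_mul, Matrix.mul_one, pow_one, Nat.cast_one,
      Nat.cast_add] at h
    have e : (A' ^ (q + 1) * A).trace = (A' ^ (q + 2)).trace + b * (A' ^ (q + 1) * H).trace := by
      conv_lhs => rw [hAA]
      rw [Matrix.mul_add, trace_add, ← pow_succ, Matrix.mul_smul, trace_smul, smul_eq_mul]
    rw [e] at h
    nlinarith
  have hsq : ∀ (B : Matrix ι ι ℝ), B.PosSemidef → ∀ k : ℕ,
      (H * H * B ^ k).trace ≤ (B ^ k).trace := by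
    intro B hB k
    have := trace_mul_nonneg_of_posSemidef hH1 (hB.pow k)
    rw [Matrix.sub_mul, Matrix.one_mul, trace_sub] at this
    linarith
  have hterm : ∀ j ∈ Finset.range (q + 1), (q : ℝ) * (A' ^ j * H * A ^ (q - j) * H).trace ≤
      j * (A' ^ q).trace + ((q - j : ℕ) : ℝ) * (A ^ q).trace := by
    intro j hj
    have hj' : j ≤ q := by simpa [Nat.lt_succ_iff] using hj
    have h := trace_mixed_le pA' pA H j (q - j)
    rw [← Nat.cast_add, Nat.add_sub_cancel' hj', hH] at h
    have e1 : (A' ^ j * H * A ^ (q - j) * H).trace = (H * A' ^ j * H * A ^ (q - j)).trace := by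
      rw [trace_mul_comm]; simp only [Matrix.mul_assoc]
    have e2 : (H * A' ^ q * H).trace = (H * H * A' ^ q).trace := by
      rw [trace_mul_comm, Matrix.mul_assoc]
    rw [e1]
    rw [e2] at h
    refine h.trans (add_le_add ?_ ?_)
    · exact mul_le_mul_of_nonneg_left (hsq _ pA' _) (by positivity)
    · exact mul_le_mul_of_nonneg_left (hsq _ pA _) (by positivity)
  have tA' : 0 ≤ (A' ^ q).trace := (pA'.pow q).trace_nonneg
  have tA : 0 ≤ (A ^ q).trace := (pA.pow q).trace_nonneg
  have hdiff : (A ^ (q + 1) * H).trace - (A' ^ (q + 1) * H).trace =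
      b * ∑ j ∈ Finset.range (q + 1), (A' ^ j * H * A ^ (q - j) * H).trace := by
    rw [← trace_sub, ← Matrix.sub_mul, pow_succ_sub_pow_succ, Finset.sum_mul, trace_sum,
      Finset.mul_sum]
    refine Finset.sum_congr rfl fun j _ => ?_
    have : A - A' = b • H := by simp [hA'def]
    rw [this, Matrix.mul_smul, Matrix.smul_mul, Matrix.smul_mul, trace_smul, smul_eq_mul]
  have hsum : 2 * ∑ j ∈ Finset.range (q + 1), (A' ^ j * H * A ^ (q - j) * H).trace ≤
      (q + 1) * ((A' ^ q).trace + (A ^ q).trace) := by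
    have h := Finset.sum_le_sum hterm
    rw [← Finset.mul_sum, Finset.sum_add_distrib, ← Finset.sum_mul, ← Finset.sum_mul] at h
    have g1 : (∑ j ∈ Finset.range (q + 1), (j : ℝ)) * 2 = (q + 1) * q := by
      have := Finset.sum_range_id_mul_two (q + 1)
      rw [Nat.add_sub_cancel] at this
      rw [← Nat.cast_sum]
      exact_mod_cast this
    have g2 : ∑ j ∈ Finset.range (q + 1), ((q - j : ℕ) : ℝ) =
        ∑ j ∈ Finset.range (q + 1), (j : ℝ) := by
      rw [← Finset.sum_range_reflect]
      refine Finset.sum_congr rfl fun j hj => ?_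
      have hj' : j ≤ q := by simpa [Nat.lt_succ_iff] using hj
      congr 1
      omega
    rw [g2] at h
    have hq' : (0 : ℝ) < q := by exact_mod_cast hq
    refine le_of_mul_le_mul_left ?_ hq'
    calc _ = 2 * (q * ∑ j ∈ Finset.range (q + 1), (A' ^ j * H * A ^ (q - j) * H).trace) := by ring
      _ ≤ (∑ j ∈ Finset.range (q + 1), (j : ℝ)) * 2 * ((A' ^ q).trace + (A ^ q).trace) := by
          linarith
      _ = _ := by rw [g1]; ring
  set β := b * ((q : ℝ) + 2) with hβ
  have hβ0 : 0 ≤ β := by positivity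
  have hbβ : b * (q + 1) ≤ β := by rw [hβ]; nlinarith
  have h4A := trace_pow_le_four_mul hA q
  have h4A' := trace_pow_le_four_mul hA' q
  have h1 : 2 * (β * (b * ∑ j ∈ Finset.range (q + 1), (A' ^ j * H * A ^ (q - j) * H).trace)) ≤
      β ^ 2 * ((A' ^ q).trace + (A ^ q).trace) := by
    calc _ = β * b * (2 * ∑ j ∈ Finset.range (q + 1), (A' ^ j * H * A ^ (q - j) * H).trace) := by
          ring
      _ ≤ β * b * ((q + 1) * ((A' ^ q).trace + (A ^ q).trace)) := by gcongr
      _ = β * (b * (q + 1)) * ((A' ^ q).trace + (A ^ q).trace) := by ring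
      _ ≤ β * β * ((A' ^ q).trace + (A ^ q).trace) := by gcongr
      _ = _ := by ring
  have h2 : β ^ 2 * ((A' ^ q).trace + (A ^ q).trace) ≤
      β ^ 2 * (4 * (A' ^ (q + 2)).trace + 4 * (A ^ (q + 2)).trace) := by gcongr
  rw [← hdiff] at h1
  nlinarith

end Trace

/-! ### Norms and the semidefinite order -/

section Norms

variable {d : ℕ}

/-- The symmetric part of a matrix; only it matters for the loss of a symmetric play. -/
noncomputable def symPart (Y : Mat d) : Mat d := (1 / 2 : ℝ) • (Y + Yᵀ)

theorem symPart_transpose (Y : Mat d) : (symPart Y)ᵀ = symPart Y := by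
  simp [symPart, add_comm]

theorem symPart_apply (Y : Mat d) (i j : Fin d) : symPart Y i j = 1 / 2 * (Y i j + Y j i) := by
  simp [symPart]

theorem matInner_eq_trace_symPart {W : Mat d} (hW : Wᵀ = W) (Y : Mat d) :
    matInner W Y = (W * symPart Y).trace := by
  have h : (W * Yᵀ).trace = (W * Y).trace := by
    rw [← trace_transpose, transpose_mul, transpose_transpose, hW, trace_mul_comm]
  rw [matInner, symPart, Matrix.mul_smul, trace_smul, Matrix.mul_add, trace_add, h, hW, smul_eq_mul]
  ring

theorem specNorm_symPart_le {Y : Mat d} (hY : specNorm Y ≤ 1) : specNorm (symPart Y) ≤ 1 := by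
  have ht : specNorm Yᵀ = specNorm Y := by
    rw [specNorm, specNorm, ← conjTranspose_eq_transpose_of_trivial, ← star_eq_conjTranspose,
      map_star]
    exact LinearIsometryEquiv.norm_map ContinuousLinearMap.adjoint _
  unfold specNorm at *
  rw [symPart, map_smul, map_add, norm_smul]
  have := norm_add_le (toEuclideanCLM (n := Fin d) (𝕜 := ℝ) Y)
    (toEuclideanCLM (n := Fin d) (𝕜 := ℝ) Yᵀ)
  norm_num
  linarith

theorem posSemidef_one_sub_sq {H : Mat d} (hH : Hᵀ = H) (h1 : specNorm H ≤ 1) :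
    (1 - H * H).PosSemidef := by
  refine PosSemidef.of_dotProduct_mulVec_nonneg ?_ fun x => ?_
  · rw [IsHermitian, conjTranspose_eq_transpose_of_trivial]
    simp [hH]
  · have h := (toEuclideanCLM (n := Fin d) (𝕜 := ℝ) H).le_of_opNorm_le h1 (WithLp.toLp 2 x)
    rw [one_mul, toEuclideanCLM_toLp] at h
    have h2 := pow_le_pow_left₀ (norm_nonneg _) h 2
    rw [EuclideanSpace.real_norm_sq_eq, EuclideanSpace.real_norm_sq_eq] at h2
    have e : star x ⬝ᵥ (1 - H * H) *ᵥ x = x ⬝ᵥ x - (H *ᵥ x) ⬝ᵥ (H *ᵥ x) := by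
      rw [sub_mulVec, one_mulVec, dotProduct_sub, star_trivial, ← mulVec_mulVec,
        dotProduct_mulVec x H, ← mulVec_transpose, hH]
    rw [e]
    simp only [dotProduct]
    simp only [pow_two] at h2
    linarith

theorem posSemidef_one_sub {H : Mat d} (hH : Hᵀ = H) (h1 : (1 - H * H).PosSemidef) :
    (1 - H).PosSemidef := by
  have h2 : ((1 - H)ᴴ * (1 - H)).PosSemidef := posSemidef_conjTranspose_mul_self _
  have h3 := (h2.add h1).smul (show (0 : ℝ) ≤ 1 / 2 by norm_num)
  convert h3 using 1
  rw [conjTranspose_eq_transpose_of_trivial, transpose_sub, transpose_one, hH]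
  have : (1 - H) * (1 - H) + (1 - H * H) = (2 : ℝ) • (1 - H) := by
    rw [two_smul]; noncomm_ring
  rw [this, smul_smul]
  norm_num

/-- The trace is at most the trace norm: evaluate the trace in an orthonormal eigenbasis of
`Wᵀ W`, whose members `W` maps to vectors with the singular values as norms. -/
theorem trace_le_traceNorm (W : Mat d) : W.trace ≤ traceNorm W := by
  set T := toEuclideanLin W with hT
  have hn : Module.finrank ℝ (EuclideanSpace ℝ (Fin d)) = d := by simp
  set e := T.isSymmetric_adjoint_comp_self.eigenvectorBasis hn with he
  have htr : W.trace = ∑ i, inner ℝ (e i) (T (e i)) := by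
    rw [← LinearMap.trace_eq_sum_inner]
    rw [hT, toEuclideanLin_eq_toLin_orthonormal, Matrix.trace_toLin_eq]
  rw [htr, traceNorm, Finset.sum_range]
  refine Finset.sum_le_sum fun i _ => ?_
  have hs := T.sq_singularValues_fin hn i
  have h2 : ‖T (e i)‖ ^ 2 = T.singularValues i ^ 2 := by
    rw [hs, ← real_inner_self_eq_norm_sq, ← LinearMap.adjoint_inner_right]
    have := T.isSymmetric_adjoint_comp_self.apply_eigenvectorBasis hn i
    rw [LinearMap.comp_apply] at this
    rw [he, this, inner_smul_right]
    simp
  have h3 : ‖T (e i)‖ = T.singularValues i :=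
    (pow_left_inj₀ (norm_nonneg _) (T.singularValues_nonneg _) two_ne_zero).mp h2
  calc inner ℝ (e i) (T (e i)) ≤ ‖e i‖ * ‖T (e i)‖ := real_inner_le_norm _ _
    _ = T.singularValues i := by rw [h3]; simp

/-- The largest eigenvalue `G` of `-S` bounds the gain of every positive semidefinite comparator,
and a single eigenvalue, `1 + b * G`, already gives a lower bound for the trace of a power. -/
theorem exists_extreme_eigenvalue [Nonempty (Fin d)] {S : Mat d} {N : ℝ}
    (hS : (N • (1 : Mat d) + S).PosSemidef) (hS' : (N • (1 : Mat d) - S).PosSemidef) :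
    ∃ G : ℝ, G ≤ N ∧
      (∀ W : Mat d, W.PosSemidef → -(W * S).trace ≤ G * W.trace) ∧
      ∀ (b : ℝ) (p : ℕ), 0 ≤ b → b * N ≤ 1 →
        (1 + b * G) ^ p ≤ (((1 : Mat d) - b • S) ^ p).trace := by
  obtain ⟨U, a, hU, hU', ha, hSa⟩ := exists_diagonalization (A := S) (c := -N)
    (by convert hS using 1; rw [neg_smul]; abel)
  obtain ⟨k, hk⟩ := Finite.exists_min a
  refine ⟨-a k, by linarith [ha k], fun W hW => ?_, fun b p hb hbN => ?_⟩
  · have h1 : (S - a k • (1 : Mat d)).PosSemidef := by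
      have : S - a k • (1 : Mat d) = U * diagonal (fun i => a i - a k) * Uᴴ := by
        have e : diagonal (fun i => a i - a k) = diagonal a - a k • (1 : Mat d) := by
          ext i j
          by_cases h : i = j
          · subst h; simp
          · simp [h]
        rw [e, conjTranspose_eq_transpose_of_trivial, Matrix.mul_sub, Matrix.sub_mul, ← hSa,
          Matrix.mul_smul, Matrix.mul_one, Matrix.smul_mul, hU']
      rw [this]
      exact (PosSemidef.diagonal fun i => sub_nonneg.mpr (hk i)).mul_mul_conjTranspose_same U
    have h2 := trace_mul_nonneg_of_posSemidef hW h1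
    rw [Matrix.mul_sub, trace_sub, Matrix.mul_smul, Matrix.mul_one, trace_smul, smul_eq_mul] at h2
    linarith
  · have e : (1 : Mat d) - b • S = U * diagonal (fun i => 1 - b * a i) * Uᵀ := by
      have e : diagonal (fun i => 1 - b * a i) = (1 : Mat d) - b • diagonal a := by
        ext i j
        by_cases h : i = j
        · subst h; simp
        · simp [h]
      rw [e, Matrix.mul_sub, Matrix.sub_mul, Matrix.mul_one, hU', Matrix.mul_smul,
        Matrix.smul_mul, ← hSa]
    rw [e, pow_conj_diagonal hU hU', trace_mul_comm, ← Matrix.mul_assoc, hU, Matrix.one_mul,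
      trace_diagonal]
    have hle : ∀ i, a i ≤ N := fun i => by
      have h := (hS'.conjTranspose_mul_mul_same U).diag_nonneg (i := i)
      have e' : Uᴴ * (N • (1 : Mat d) - S) * U = N • (1 : Mat d) - diagonal a := by
        rw [hSa, conjTranspose_eq_transpose_of_trivial]
        calc Uᵀ * (N • (1 : Mat d) - U * diagonal a * Uᵀ) * U
            = N • (Uᵀ * U) - (Uᵀ * U) * diagonal a * (Uᵀ * U) := by
              simp only [Matrix.mul_sub, Matrix.sub_mul, Matrix.mul_smul, Matrix.smul_mul,
                Matrix.mul_one, Matrix.mul_assoc]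
          _ = _ := by rw [hU, Matrix.one_mul, Matrix.mul_one]
      rw [e'] at h
      simpa using h
    have hnn : ∀ i, 0 ≤ (1 - b * a i) ^ p := fun i =>
      pow_nonneg (by nlinarith [hle i, mul_le_mul_of_nonneg_left (hle i) hb]) p
    refine le_trans (le_of_eq ?_) (Finset.single_le_sum (fun i _ => hnn i) (Finset.mem_univ k))
    ring

end Norms

/-! ### Semantics of loops -/

section Semantics

/-- Induction over the iterations of a loop: an invariant that holds at the start and is kept by
every iteration holds at the end. -/
theorem exec_loop_induct (I : ℕ → State → Prop) (x : ℕ) (e : NExp) (body : Prog) (s : State)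
    (h0 : I 0 (s.tick (e.cost + 1)))
    (hs : ∀ i < e.eval s.nat, ∀ s', I i s' → I (i + 1) (body.exec ((s'.setNat x i).tick 1))) :
    I (e.eval s.nat) ((Prog.loop x e body).exec s) := by
  rw [Prog.exec]
  have : ∀ m ≤ e.eval s.nat, I m ((List.range m).foldl
      (fun s' i => body.exec ((s'.setNat x i).tick 1)) (s.tick (e.cost + 1))) := by
    intro m
    induction m with
    | zero => intro _; simpa using h0
    | succ m ih =>
      intro hm
      rw [List.range_succ, List.foldl_append]
      exact hs m (by omega) _ (ih (by omega))
  exact this _ le_rfl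

/-- Add the values of `g` for `x = 0, …, e - 1` to the entry `(i, j, k)` of the array `a`. -/
def accumulate (x : ℕ) (e : NExp) (a : ℕ) (i j k : NExp) (g : RExp) : Prog :=
  .loop x e (.store a i j k (.add (.load a i j k) g))

/-- The hypothesis says that in every state met by the loop the indices and the value of `g` do not
depend on the entry that is being updated. -/
theorem exec_accumulate {x : ℕ} {e : NExp} {a : ℕ} {i j k : NExp} {g : RExp} {s : State}
    {I J K : ℕ} {G : ℕ → ℝ}
    (h : ∀ l < e.eval s.nat, ∀ s' : State, (∀ y, y ≠ x → s'.nat y = s.nat y) → s'.nat x = l →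
      (∀ a' i' j' k', ¬(a' = a ∧ i' = I ∧ j' = J ∧ k' = K) →
        s'.real a' i' j' k' = s.real a' i' j' k') →
      i.eval s'.nat = I ∧ j.eval s'.nat = J ∧ k.eval s'.nat = K ∧
        g.eval s'.nat s'.real = G l) :
    (∀ y, y ≠ x → ((accumulate x e a i j k g).exec s).nat y = s.nat y) ∧
      ((accumulate x e a i j k g).exec s).real = (s.setReal a I J K
        (s.real a I J K + ∑ l ∈ Finset.range (e.eval s.nat), G l)).real := by
  refine exec_loop_induct (fun m s' => (∀ y, y ≠ x → s'.nat y = s.nat y) ∧ s'.real =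
    (s.setReal a I J K (s.real a I J K + ∑ l ∈ Finset.range m, G l)).real) x e _ s ?_ ?_
  · refine ⟨fun y _ => rfl, ?_⟩
    funext a' i' j' k'
    simp only [State.tick, State.setReal, Finset.range_zero, Finset.sum_empty, add_zero]
    split_ifs with hc
    · obtain ⟨rfl, rfl, rfl, rfl⟩ := hc; rfl
    · rfl
  · rintro l hl s' ⟨hn, hr⟩
    set s₁ := (s'.setNat x l).tick 1 with hs₁
    have hn₁ : ∀ y, y ≠ x → s₁.nat y = s.nat y := fun y hy => by
      simp [hs₁, State.tick, State.setNat, hy, hn]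
    have hr₁ : s₁.real = s'.real := rfl
    obtain ⟨hi, hj, hk, hg⟩ := h l hl s₁ hn₁ (by simp [hs₁, State.tick, State.setNat])
      (fun a' i' j' k' hc => by rw [hr₁, hr]; simp [State.setReal, hc])
    refine ⟨fun y hy => hn₁ y hy, ?_⟩
    funext a' i' j' k'
    simp only [Prog.exec, State.tick, State.setReal, RExp.eval, hi, hj, hk, hg]
    rw [hr₁, hr]
    simp only [State.setReal]
    split_ifs with hc hc2
    · rw [Finset.sum_range_succ, add_assoc]
    · simp at hc2
    · rfl

/-- Run `body` for all pairs of indices `3`, `4` below the dimension. -/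
def forEntries (body : Prog) : Prog := .loop 3 (.var 1) (.loop 4 (.var 1) body)

/-- If `body` writes `f i j` into the entry `(m, i, j)` of the array `a`, without using the other
entries of this slice and changing no variable but `5`, then `forEntries body` writes the matrix `f`
into the slice and leaves the rest of the memory alone. -/
theorem exec_forEntries {body : Prog} {s : State} {a m d : ℕ} {f : ℕ → ℕ → ℝ} (hd : s.nat 1 = d)
    (h : ∀ i < d, ∀ j < d, ∀ s' : State, s'.nat 3 = i → s'.nat 4 = j →
      (∀ y, y ≠ 3 → y ≠ 4 → y ≠ 5 → s'.nat y = s.nat y) →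
      (∀ a' m' i' j', ¬(a' = a ∧ m' = m) → s'.real a' m' i' j' = s.real a' m' i' j') →
      s'.real a m i j = s.real a m i j →
      (∀ y, y ≠ 5 → (body.exec s').nat y = s'.nat y) ∧
        (body.exec s').real = (s'.setReal a m i j (f i j)).real) :
    (∀ y, y ≠ 3 → y ≠ 4 → y ≠ 5 → ((forEntries body).exec s).nat y = s.nat y) ∧
      ∀ a' m' i' j', ((forEntries body).exec s).real a' m' i' j' =
        if a' = a ∧ m' = m ∧ i' < d ∧ j' < d then f i' j' else s.real a' m' i' j' := by
  subst hd
  have key := exec_loop_induct (fun i s' => (∀ y, y ≠ 3 → y ≠ 4 → y ≠ 5 → s'.nat y = s.nat y) ∧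
    ∀ a' m' i' j', s'.real a' m' i' j' =
      if a' = a ∧ m' = m ∧ i' < i ∧ j' < s.nat 1 then f i' j' else s.real a' m' i' j')
    3 (.var 1) (.loop 4 (.var 1) body) s
    ⟨fun y _ _ _ => rfl, fun a' m' i' j' => by simp [State.tick]⟩ ?_
  · exact key
  rintro i hi s' ⟨hn, hr⟩
  have hi' : i < s.nat 1 := hi
  set s₁ := (s'.setNat 3 i).tick 1 with hs₁
  have hn₁ : ∀ y, y ≠ 3 → y ≠ 4 → y ≠ 5 → s₁.nat y = s.nat y := fun y h3 h4 h5 => by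
    simp [hs₁, State.tick, State.setNat, h3, hn y h3 h4 h5]
  have h1 : (NExp.var 1).eval s₁.nat = s.nat 1 := hn₁ 1 (by simp) (by simp) (by simp)
  have inner := exec_loop_induct (fun j s'' => (s''.nat 3 = i ∧
      ∀ y, y ≠ 3 → y ≠ 4 → y ≠ 5 → s''.nat y = s.nat y) ∧
    ∀ a' m' i' j', s''.real a' m' i' j' =
      if a' = a ∧ m' = m ∧ (i' < i ∧ j' < s.nat 1 ∨ i' = i ∧ j' < j) then f i' j'
      else s.real a' m' i' j')
    4 (.var 1) body s₁
    ⟨⟨by simp [hs₁, State.tick, State.setNat], hn₁⟩, fun a' m' i' j' => by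
      simpa [hs₁, State.tick, State.setNat] using hr a' m' i' j'⟩ ?_
  · rw [h1] at inner
    refine ⟨inner.1.2, fun a' m' i' j' => ?_⟩
    rw [inner.2]
    refine if_congr ?_ rfl rfl
    constructor
    · rintro ⟨ha, hm, h⟩
      refine ⟨ha, hm, ?_⟩
      omega
    · rintro ⟨ha, hm, h⟩
      refine ⟨ha, hm, ?_⟩
      omega
  rintro j hj s'' ⟨⟨h3, hn₂⟩, hr₂⟩
  rw [h1] at hj
  set s₂ := (s''.setNat 4 j).tick 1 with hs₂
  have hreal : s₂.real = s''.real := rfl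
  obtain ⟨gn, gr⟩ := h i hi' j hj s₂ (by simp [hs₂, State.tick, State.setNat, h3])
    (by simp [hs₂, State.tick, State.setNat])
    (fun y h3 h4 h5 => by simp [hs₂, State.tick, State.setNat, h4, hn₂ y h3 h4 h5])
    (fun a' m' i' j' hc => by
      rw [hreal, hr₂, if_neg]
      exact fun hc' => hc ⟨hc'.1, hc'.2.1⟩)
    (by
      rw [hreal, hr₂, if_neg]
      rintro ⟨-, -, h | h⟩ <;> omega)
  refine ⟨⟨?_, fun y h3 h4 h5 => ?_⟩, fun a' m' i' j' => ?_⟩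
  · rw [gn 3 (by simp)]; simp [hs₂, State.tick, State.setNat, h3]
  · rw [gn y h5]; simp [hs₂, State.tick, State.setNat, h4, hn₂ y h3 h4 h5]
  · rw [gr]
    simp only [State.setReal]
    rw [hreal, hr₂]
    by_cases hc : a' = a ∧ m' = m ∧ i' = i ∧ j' = j
    · rw [if_pos hc, if_pos ⟨hc.1, hc.2.1, by omega⟩, hc.2.2.1, hc.2.2.2]
    · rw [if_neg hc]
      refine if_congr ?_ rfl rfl
      constructor
      · rintro ⟨ha, hm, h⟩
        exact ⟨ha, hm, by omega⟩
      · rintro ⟨ha, hm, h⟩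
        refine ⟨ha, hm, ?_⟩
        have : ¬ (i' = i ∧ j' = j) := fun h' => hc ⟨ha, hm, h'⟩
        omega

end Semantics

/-! ### Running time -/

section RunningTime

/-- Loop bounds that a program may use: they only involve the input variables `0`, `1`, `2`, and
are at most `n + d` when the number of past rounds is at most `n` and `d ≥ 1`. -/
inductive SmallBound : NExp → Prop
  | horizon : SmallBound (.var 0)
  | dimension : SmallBound (.var 1)
  | past : SmallBound (.var 2)
  | horizon_succ : SmallBound (.add (.var 0) (.const 1))

/-- All loops have small bounds, and the input variables `0`, `1`, `2` are never written. -/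
def Prog.Safe : Prog → Prop
  | .skip => True
  | .setNat x _ => 3 ≤ x
  | .store _ _ _ _ _ => True
  | .flip x => 3 ≤ x
  | .seq p q => p.Safe ∧ q.Safe
  | .ite _ p q => p.Safe ∧ q.Safe
  | .loop x e body => 3 ≤ x ∧ SmallBound e ∧ body.Safe

/-- A bound for the running time when every loop makes at most `N` iterations. -/
def Prog.timeBound (N : ℕ) : Prog → ℕ
  | .skip => 1
  | .setNat _ e => e.cost + 1
  | .store _ i j k e => i.cost + j.cost + k.cost + e.cost + 1
  | .flip _ => 1
  | .seq p q => p.timeBound N + q.timeBound N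
  | .ite b p q => b.cost + 1 + p.timeBound N + q.timeBound N
  | .loop _ e body => e.cost + 1 + N * (body.timeBound N + 1)

/-- The variables `0`, `1`, `2` have to be preserved along with the time bound, since the bounds of
later loops depend on them. -/
theorem exec_time_le {N : ℕ} (P : Prog) (hP : P.Safe) (s : State) (h0 : s.nat 0 + 1 ≤ N)
    (h1 : s.nat 1 ≤ N) (h2 : s.nat 2 ≤ N) :
    (∀ y < 3, (P.exec s).nat y = s.nat y) ∧ (P.exec s).time ≤ s.time + P.timeBound N := by
  induction P generalizing s with
  | skip => exact ⟨fun _ _ => rfl, le_rfl⟩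
  | setNat x e =>
    refine ⟨fun y hy => ?_, le_rfl⟩
    simp only [Prog.Safe] at hP
    simp [Prog.exec, State.tick, State.setNat, show y ≠ x by omega]
  | store a i j k e => exact ⟨fun _ _ => rfl, le_rfl⟩
  | flip x =>
    refine ⟨fun y hy => ?_, le_rfl⟩
    simp only [Prog.Safe] at hP
    simp [Prog.exec, State.tick, State.setNat, State.flip, show y ≠ x by omega]
  | seq p q ihp ihq =>
    obtain ⟨a, b⟩ := ihp hP.1 s h0 h1 h2
    obtain ⟨c, e⟩ := ihq hP.2 (p.exec s) (by rw [a 0 (by simp)]; exact h0)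
      (by rw [a 1 (by simp)]; exact h1) (by rw [a 2 (by simp)]; exact h2)
    refine ⟨fun y hy => (c y hy).trans (a y hy), ?_⟩
    simp only [Prog.exec, Prog.timeBound]
    omega
  | ite b p q ihp ihq =>
    simp only [Prog.exec, Prog.timeBound]
    split_ifs
    · obtain ⟨a, c⟩ := ihp hP.1 (s.tick (b.cost + 1)) h0 h1 h2
      refine ⟨a, ?_⟩
      simp only [State.tick] at c ⊢
      omega
    · obtain ⟨a, c⟩ := ihq hP.2 (s.tick (b.cost + 1)) h0 h1 h2
      refine ⟨a, ?_⟩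
      simp only [State.tick] at c ⊢
      omega
  | loop x e body ih =>
    obtain ⟨hx, he, hb⟩ := hP
    have heN : e.eval s.nat ≤ N := by
      cases he <;> simp only [NExp.eval] <;> omega
    have key := exec_loop_induct (fun i s' => (∀ y < 3, s'.nat y = s.nat y) ∧
      s'.time ≤ s.time + (e.cost + 1) + i * (body.timeBound N + 1)) x e body s
      ⟨fun _ _ => rfl, by simp [State.tick]⟩ ?_
    · refine ⟨key.1, key.2.trans ?_⟩
      simp only [Prog.timeBound]
      have := Nat.mul_le_mul_right (body.timeBound N + 1) heN
      omega
    · rintro i - s' ⟨hn, ht⟩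
      have hn' : ∀ y < 3, ((s'.setNat x i).tick 1).nat y = s.nat y := fun y hy => by
        simp [State.tick, State.setNat, show y ≠ x by omega, hn y hy]
      obtain ⟨a, c⟩ := ih hb ((s'.setNat x i).tick 1) (by rw [hn' 0 (by simp)]; exact h0)
        (by rw [hn' 1 (by simp)]; exact h1) (by rw [hn' 2 (by simp)]; exact h2)
      refine ⟨fun y hy => (a y hy).trans (hn' y hy), c.trans ?_⟩
      simp only [State.tick, State.setNat]
      rw [add_mul]
      omega

/-- The running-time bound is polynomial in the number of iterations. -/
theorem exists_timeBound_le (P : Prog) :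
    ∃ c k : ℕ, ∀ N, 1 ≤ N → P.timeBound N ≤ c * N ^ k := by
  have const : ∀ c : ℕ, ∃ c' k : ℕ, ∀ N, 1 ≤ N → c ≤ c' * N ^ k := fun c => ⟨c, 0, by simp⟩
  have add : ∀ f g : ℕ → ℕ, (∃ c k : ℕ, ∀ N, 1 ≤ N → f N ≤ c * N ^ k) →
      (∃ c k : ℕ, ∀ N, 1 ≤ N → g N ≤ c * N ^ k) →
      ∃ c k : ℕ, ∀ N, 1 ≤ N → f N + g N ≤ c * N ^ k := by
    rintro f g ⟨c, k, hf⟩ ⟨c', k', hg⟩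
    refine ⟨c + c', k + k', fun N hN => ?_⟩
    rw [add_mul]
    refine add_le_add ((hf N hN).trans ?_) ((hg N hN).trans ?_)
    · exact Nat.mul_le_mul_left _ (Nat.pow_le_pow_right hN (by omega))
    · exact Nat.mul_le_mul_left _ (Nat.pow_le_pow_right hN (by omega))
  induction P with
  | skip => exact const _
  | setNat x e => exact const _
  | store a i j k e => exact const _
  | flip x => exact const _
  | seq p q ihp ihq => exact add _ _ ihp ihq
  | ite b p q ihp ihq => exact add _ _ (add _ _ (const _) ihp) ihq
  | loop x e body ih =>
    refine add _ _ (const _) ?_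
    obtain ⟨c, k, h⟩ := add _ _ ih (const 1)
    refine ⟨c, k + 1, fun N hN => ?_⟩
    calc N * (body.timeBound N + 1) ≤ N * (c * N ^ k) := Nat.mul_le_mul_left _ (h N hN)
      _ = c * N ^ (k + 1) := by ring

end RunningTime

/-! ### The strategy and its program -/

section Strategy

/-- The betting rates `1 / (2 n), 2 / (2 n), …, n / (2 n)`. -/
noncomputable def rate (n k : ℕ) : ℝ := ((k + 1 : ℕ) : ℝ) / ((2 * n : ℕ) : ℝ)

/-- The second-order correction `2 β²` for the betting rate `β`. -/
noncomputable def corr (n k : ℕ) : ℝ := 2 * (rate n k * rate n k)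

/-- The weight of the `k`-th betting rate after `t` rounds. The factor `n - 1` makes the play zero
when there is a single round, where the regret bound for the comparator `0` is `0`. -/
noncomputable def weight (n d k t : ℕ) : ℝ :=
  ((n - 1 : ℕ) : ℝ) / ((n * n * d : ℕ) : ℝ) * (rate n k / (1 + corr n k)) *
    ((1 - corr n k) / (1 + corr n k)) ^ t

/-- The base `1 - β / (n + 2) • S` of the power that replaces `exp (-β S)`, for the `k`-th rate
`β`. -/
noncomputable def base {d : ℕ} (n k : ℕ) (S : Mat d) : Mat d :=
  1 - (rate n k / ((n + 2 : ℕ) : ℝ)) • S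

/-- The sum of the symmetric parts of the past loss matrices. -/
noncomputable def lossSum {d : ℕ} (Ys : List (Mat d)) : Mat d :=
  ∑ s ∈ Finset.range Ys.length, symPart (Ys.getD s 0)

/-- The matrix played after the losses `Ys`: a mixture over betting rates of gradients of the
trace potentials. -/
noncomputable def strategy (n : ℕ) {d : ℕ} (Ys : List (Mat d)) : Mat d :=
  ∑ k ∈ Finset.range n, weight n d k Ys.length • base n k (lossSum Ys) ^ (n + 1)

/-- Expression for `rate`, with `k` in the variable `6`. -/
def rateExp : RExp :=
  .div (.ofNat (.add (.var 6) (.const 1))) (.ofNat (.mul (.const 2) (.var 0)))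

/-- Expression for `corr`. -/
def corrExp : RExp := .mul (.ofNat (.const 2)) (.mul rateExp rateExp)

/-- Expression for the entry `(x, y)` of the identity matrix, by truncated subtraction. -/
def deltaExp (x y : NExp) : RExp :=
  .ofNat (.sub (.const 1) (.add (.sub x y) (.sub y x)))

/-- Write `lossSum` into the array `2`. -/
def lossSumProg : Prog :=
  forEntries (accumulate 5 (.var 2) 2 (.const 0) (.var 3) (.var 4)
    (.mul (.div (.ofNat (.const 1)) (.ofNat (.const 2)))
      (.add (.load 0 (.var 5) (.var 3) (.var 4)) (.load 0 (.var 5) (.var 4) (.var 3)))))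

/-- Write `weight` into the array `3`. -/
def weightProg : Prog :=
  .seq
    (.store 3 (.const 0) (.const 0) (.const 0)
      (.mul (.div (.ofNat (.sub (.var 0) (.const 1)))
          (.ofNat (.mul (.mul (.var 0) (.var 0)) (.var 1))))
        (.div rateExp (.add (.ofNat (.const 1)) corrExp))))
    (.loop 5 (.var 2)
      (.store 3 (.const 0) (.const 0) (.const 0)
        (.mul (.load 3 (.const 0) (.const 0) (.const 0))
          (.div (.sub (.ofNat (.const 1)) corrExp) (.add (.ofNat (.const 1)) corrExp)))))

/-- Write `weight • 1` into slice `0` of the array `4`. -/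
def initPowerProg : Prog :=
  forEntries (.store 4 (.const 0) (.var 3) (.var 4)
    (.mul (.load 3 (.const 0) (.const 0) (.const 0)) (deltaExp (.var 3) (.var 4))))

/-- Multiply the slice of the array `4` with the number in the variable `7` by `base`, and write
the result into the next slice. -/
def mulProg : Prog :=
  forEntries (.seq
    (.store 4 (.add (.var 7) (.const 1)) (.var 3) (.var 4) (.ofNat (.const 0)))
    (accumulate 5 (.var 1) 4 (.add (.var 7) (.const 1)) (.var 3) (.var 4)
      (.mul (.load 4 (.var 7) (.var 3) (.var 5))
        (.sub (deltaExp (.var 5) (.var 4))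
          (.mul (.div rateExp (.ofNat (.add (.var 0) (.const 2))))
            (.load 2 (.const 0) (.var 5) (.var 4)))))))

/-- Add the last power to the output array `1`. -/
def addProg : Prog :=
  forEntries (.store 1 (.const 0) (.var 3) (.var 4)
    (.add (.load 1 (.const 0) (.var 3) (.var 4))
      (.load 4 (.add (.var 0) (.const 1)) (.var 3) (.var 4))))

/-- Add the contribution of one betting rate to the output. -/
def rateProg : Prog :=
  .seq weightProg (.seq initPowerProg
    (.seq (.loop 7 (.add (.var 0) (.const 1)) mulProg) addProg))

/-- The program that computes `strategy`. -/
def strategyProg : Prog := .seq lossSumProg (.loop 6 (.var 0) rateProg)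

theorem strategyProg_safe : strategyProg.Safe := by
  simp only [strategyProg, rateProg, lossSumProg, weightProg, initPowerProg, mulProg, addProg,
    forEntries, accumulate, Prog.Safe, and_true]
  refine ⟨?_, ?_⟩ <;>
    simp [SmallBound.horizon, SmallBound.dimension, SmallBound.past, SmallBound.horizon_succ]

theorem deltaExp_eval (x y : NExp) (v : ℕ → ℕ) (m : ℕ → ℕ → ℕ → ℕ → ℝ) :
    (deltaExp x y).eval v m = if x.eval v = y.eval v then 1 else 0 := by
  simp only [deltaExp, RExp.eval, NExp.eval]
  split_ifs with h
  · simp [h]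
  · rw [show 1 - (x.eval v - y.eval v + (y.eval v - x.eval v)) = 0 by omega, Nat.cast_zero]

theorem rateExp_eval (v : ℕ → ℕ) (m : ℕ → ℕ → ℕ → ℕ → ℝ) :
    rateExp.eval v m = rate (v 0) (v 6) := rfl

theorem corrExp_eval (v : ℕ → ℕ) (m : ℕ → ℕ → ℕ → ℕ → ℝ) :
    corrExp.eval v m = corr (v 0) (v 6) := by
  simp [corrExp, RExp.eval, NExp.eval, rateExp_eval, corr]

/-- The entries of a matrix, with `0` outside the index range. -/
def entry {d : ℕ} (A : Mat d) (i j : ℕ) : ℝ :=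
  if h : i < d ∧ j < d then A ⟨i, h.1⟩ ⟨j, h.2⟩ else 0

theorem entry_of_lt {d : ℕ} (A : Mat d) {i j : ℕ} (hi : i < d) (hj : j < d) :
    entry A i j = A ⟨i, hi⟩ ⟨j, hj⟩ := dif_pos ⟨hi, hj⟩

theorem exec_lossSumProg {s : State} {d : ℕ} {Ys : List (Mat d)} (hd : s.nat 1 = d)
    (ht : s.nat 2 = Ys.length) (h2 : ∀ i j, s.real 2 0 i j = 0)
    (h0 : ∀ l i j, i < d → j < d → s.real 0 l i j = entry (Ys.getD l 0) i j) :
    (∀ y, y ≠ 3 → y ≠ 4 → y ≠ 5 → (lossSumProg.exec s).nat y = s.nat y) ∧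
      ∀ a' m' i' j', (lossSumProg.exec s).real a' m' i' j' =
        if a' = 2 ∧ m' = 0 ∧ i' < d ∧ j' < d then entry (lossSum Ys) i' j'
        else s.real a' m' i' j' := by
  refine exec_forEntries hd fun i hi j hj s' h3 h4 hn hr hc => ?_
  have key := exec_accumulate (x := 5) (e := .var 2) (a := 2) (i := .const 0) (j := .var 3)
    (k := .var 4) (s := s') (I := 0) (J := i) (K := j)
    (g := .mul (.div (.ofNat (.const 1)) (.ofNat (.const 2)))
      (.add (.load 0 (.var 5) (.var 3) (.var 4)) (.load 0 (.var 5) (.var 4) (.var 3))))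
    (G := fun l => entry (symPart (Ys.getD l 0)) i j) ?_
  · refine ⟨key.1, ?_⟩
    refine key.2.trans ?_
    congr 2
    rw [hc, h2, zero_add]
    simp only [NExp.eval, hn 2 (by simp) (by simp) (by simp), ht]
    rw [entry_of_lt _ hi hj, lossSum, Matrix.sum_apply]
    exact Finset.sum_congr rfl fun l _ => entry_of_lt _ hi hj
  · intro l hl s'' hn' h5 hr'
    refine ⟨rfl, ?_, ?_, ?_⟩
    · simp [NExp.eval, hn', h3]
    · simp [NExp.eval, hn', h4]
    · simp only [RExp.eval, NExp.eval, h5, hn' 3 (by simp), hn' 4 (by simp), h3, h4]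
      rw [hr' _ _ _ _ (by simp), hr' _ _ _ _ (by simp), hr _ _ _ _ (by simp),
        hr _ _ _ _ (by simp), h0 _ _ _ hi hj, h0 _ _ _ hj hi, entry_of_lt _ hi hj,
        entry_of_lt _ hi hj, entry_of_lt _ hj hi, symPart_apply]
      norm_num

theorem exec_weightProg (s : State) :
    (∀ y, y ≠ 5 → (weightProg.exec s).nat y = s.nat y) ∧
      (weightProg.exec s).real =
        (s.setReal 3 0 0 0 (weight (s.nat 0) (s.nat 1) (s.nat 6) (s.nat 2))).real := by
  refine exec_loop_induct (fun t s' => (∀ y, y ≠ 5 → s'.nat y = s.nat y) ∧ s'.real =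
    (s.setReal 3 0 0 0 (weight (s.nat 0) (s.nat 1) (s.nat 6) t)).real) 5 (.var 2) _ _ ?_ ?_
  · refine ⟨fun _ _ => rfl, ?_⟩
    funext a i j k
    simp [Prog.exec, State.tick, State.setReal, RExp.eval, NExp.eval, rateExp_eval, corrExp_eval,
      weight]
  · rintro t - s' ⟨hn, hr⟩
    refine ⟨fun y hy => ?_, ?_⟩
    · simp [Prog.exec, State.tick, State.setReal, State.setNat, hy, hn]
    · funext a i j k
      have hu : ∀ y, y ≠ 5 → Function.update s'.nat 5 t y = s.nat y := fun y hy => by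
        rw [Function.update_of_ne hy, hn y hy]
      simp only [Prog.exec, State.tick, State.setReal, State.setNat, RExp.eval, NExp.eval,
        corrExp_eval, hr, hu 0 (by simp), hu 6 (by simp), and_self, if_true, weight, pow_succ]
      split_ifs
      · simp only [Nat.cast_one, mul_assoc]
      · rfl

theorem exec_initPowerProg {s : State} {d : ℕ} (hd : s.nat 1 = d) :
    (∀ y, y ≠ 3 → y ≠ 4 → y ≠ 5 → (initPowerProg.exec s).nat y = s.nat y) ∧
      ∀ a' m' i' j', (initPowerProg.exec s).real a' m' i' j' =
        if a' = 4 ∧ m' = 0 ∧ i' < d ∧ j' < d then entry (s.real 3 0 0 0 • (1 : Mat d)) i' j'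
        else s.real a' m' i' j' := by
  refine exec_forEntries hd fun i hi j hj s' h3 h4 hn hr hc => ⟨fun _ _ => rfl, ?_⟩
  simp only [Prog.exec, State.tick, RExp.eval, NExp.eval, deltaExp_eval, h3, h4]
  congr 2
  rw [hr _ _ _ _ (by simp), entry_of_lt _ hi hj]
  simp [Matrix.one_apply]

theorem exec_mulProg {s : State} {d : ℕ} {A S : Mat d} (hd : s.nat 1 = d)
    (h2 : ∀ i j, i < d → j < d → s.real 2 0 i j = entry S i j)
    (h4 : ∀ i j, i < d → j < d → s.real 4 (s.nat 7) i j = entry A i j) :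
    (∀ y, y ≠ 3 → y ≠ 4 → y ≠ 5 → (mulProg.exec s).nat y = s.nat y) ∧
      ∀ a' m' i' j', (mulProg.exec s).real a' m' i' j' =
        if a' = 4 ∧ m' = s.nat 7 + 1 ∧ i' < d ∧ j' < d then
          entry (A * base (s.nat 0) (s.nat 6) S) i' j'
        else s.real a' m' i' j' := by
  refine exec_forEntries hd fun i hi j hj s' g3 g4 hn hr hc => ?_
  set s₁ := (Prog.store 4 (.add (.var 7) (.const 1)) (.var 3) (.var 4) (.ofNat (.const 0))).exec s'
    with hs₁
  have n7 : s'.nat 7 = s.nat 7 := hn 7 (by simp) (by simp) (by simp)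
  have n1 : s'.nat 1 = d := (hn 1 (by simp) (by simp) (by simp)).trans hd
  have n0 : s'.nat 0 = s.nat 0 := hn 0 (by simp) (by simp) (by simp)
  have n6 : s'.nat 6 = s.nat 6 := hn 6 (by simp) (by simp) (by simp)
  have e1 : s₁.real = (s'.setReal 4 (s.nat 7 + 1) i j 0).real := by
    simp [hs₁, Prog.exec, State.tick, NExp.eval, RExp.eval, n7, g3, g4]
  have e1n : s₁.nat = s'.nat := rfl
  have key := exec_accumulate (x := 5) (e := .var 1) (a := 4) (i := .add (.var 7) (.const 1))
    (j := .var 3) (k := .var 4) (s := s₁) (I := s.nat 7 + 1) (J := i) (K := j)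
    (g := .mul (.load 4 (.var 7) (.var 3) (.var 5))
        (.sub (deltaExp (.var 5) (.var 4))
          (.mul (.div rateExp (.ofNat (.add (.var 0) (.const 2))))
            (.load 2 (.const 0) (.var 5) (.var 4)))))
    (G := fun l => entry A i l * entry (base (s.nat 0) (s.nat 6) S) l j) ?_
  · refine ⟨key.1, key.2.trans ?_⟩
    funext a' m' i' j'
    simp only [State.setReal, e1, and_self, if_true, zero_add, NExp.eval, e1n, n1]
    split_ifs with hc
    · rw [entry_of_lt _ hi hj, Matrix.mul_apply, Finset.sum_range]
      exact Finset.sum_congr rfl fun l _ => by rw [entry_of_lt _ hi l.2, entry_of_lt _ l.2 hj]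
    · rfl
  · intro l hl s'' hn' h5 hr'
    have hl : l < d := by simpa [NExp.eval, e1n, n1] using hl
    have m7 : s''.nat 7 = s.nat 7 := by rw [hn' 7 (by simp), e1n, n7]
    have m3 : s''.nat 3 = i := by rw [hn' 3 (by simp), e1n, g3]
    have m4 : s''.nat 4 = j := by rw [hn' 4 (by simp), e1n, g4]
    have m0 : s''.nat 0 = s.nat 0 := by rw [hn' 0 (by simp), e1n, n0]
    have m6 : s''.nat 6 = s.nat 6 := by rw [hn' 6 (by simp), e1n, n6]
    refine ⟨by simp [NExp.eval, m7], by simp [NExp.eval, m3], by simp [NExp.eval, m4], ?_⟩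
    simp only [RExp.eval, NExp.eval, deltaExp_eval, rateExp_eval, m7, m3, m4, m0, m6, h5]
    have r4 : s''.real 4 (s.nat 7) i l = entry A i l := by
      rw [hr' _ _ _ _ (by simp), e1]
      simp only [State.setReal]
      rw [if_neg (by simp), hr _ _ _ _ (by simp), h4 _ _ hi hl]
    have r2 : s''.real 2 0 l j = entry S l j := by
      rw [hr' _ _ _ _ (by simp), e1]
      simp only [State.setReal]
      rw [if_neg (by simp), hr _ _ _ _ (by simp), h2 _ _ hl hj]
    rw [r4, r2, entry_of_lt (base _ _ _) hl hj, entry_of_lt S hl hj]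
    simp [base, Matrix.one_apply]

theorem exec_powerLoop {s : State} {d : ℕ} {S : Mat d} {c : ℝ} (hd : s.nat 1 = d)
    (h2 : ∀ i j, i < d → j < d → s.real 2 0 i j = entry S i j)
    (h4 : ∀ i j, i < d → j < d → s.real 4 0 i j = entry (c • (1 : Mat d)) i j) :
    let s' := (Prog.loop 7 (.add (.var 0) (.const 1)) mulProg).exec s
    (∀ y, y ≠ 3 → y ≠ 4 → y ≠ 5 → y ≠ 7 → s'.nat y = s.nat y) ∧
      (∀ a, a ≠ 4 → s'.real a = s.real a) ∧
      ∀ i j, i < d → j < d → s'.real 4 (s.nat 0 + 1) i j =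
        entry (c • base (s.nat 0) (s.nat 6) S ^ (s.nat 0 + 1)) i j := by
  intro s'
  refine exec_loop_induct (fun m s' =>
    (∀ y, y ≠ 3 → y ≠ 4 → y ≠ 5 → y ≠ 7 → s'.nat y = s.nat y) ∧
      (∀ a, a ≠ 4 → s'.real a = s.real a) ∧
      ∀ i j, i < d → j < d → s'.real 4 m i j =
        entry (c • base (s.nat 0) (s.nat 6) S ^ m) i j) 7 _ mulProg s ?_ ?_
  · exact ⟨fun _ _ _ _ _ => rfl, fun _ _ => rfl, fun i j hi hj => by
      simpa [State.tick] using h4 i j hi hj⟩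
  · rintro m - s₁ ⟨hn, hr, hp⟩
    set s₂ := (s₁.setNat 7 m).tick 1 with hs₂
    have hn₂ : ∀ y, y ≠ 3 → y ≠ 4 → y ≠ 5 → y ≠ 7 → s₂.nat y = s.nat y := fun y y3 y4 y5 y7 => by
      simp [hs₂, State.tick, State.setNat, y7, hn y y3 y4 y5 y7]
    have n7 : s₂.nat 7 = m := by simp [hs₂, State.tick, State.setNat]
    have hr₂ : s₂.real = s₁.real := rfl
    obtain ⟨kn, kr⟩ := exec_mulProg (s := s₂) (S := S)
      (A := c • base (s.nat 0) (s.nat 6) S ^ m)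
      ((hn₂ 1 (by simp) (by simp) (by simp) (by simp)).trans hd)
      (fun i j hi hj => by rw [hr₂, hr 2 (by simp)]; exact h2 i j hi hj)
      (fun i j hi hj => by rw [hr₂, n7]; exact hp i j hi hj)
    refine ⟨fun y y3 y4 y5 y7 => (kn y y3 y4 y5).trans (hn₂ y y3 y4 y5 y7), fun a ha => ?_,
      fun i j hi hj => ?_⟩
    · funext m' i' j'
      rw [kr, if_neg (by simp [ha]), hr₂, hr a ha]
    · rw [kr, if_pos ⟨rfl, by rw [n7], hi, hj⟩, hn₂ 0 (by simp) (by simp) (by simp) (by simp),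
        hn₂ 6 (by simp) (by simp) (by simp) (by simp), Matrix.smul_mul, ← pow_succ]

theorem exec_addProg {s : State} {d : ℕ} {A B : Mat d} (hd : s.nat 1 = d)
    (h1 : ∀ i j, i < d → j < d → s.real 1 0 i j = entry A i j)
    (h4 : ∀ i j, i < d → j < d → s.real 4 (s.nat 0 + 1) i j = entry B i j) :
    (∀ y, y ≠ 3 → y ≠ 4 → y ≠ 5 → (addProg.exec s).nat y = s.nat y) ∧
      ∀ a' m' i' j', (addProg.exec s).real a' m' i' j' =
        if a' = 1 ∧ m' = 0 ∧ i' < d ∧ j' < d then entry (A + B) i' j'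
        else s.real a' m' i' j' := by
  refine exec_forEntries hd fun i hi j hj s' h3 g4 hn hr hc => ⟨fun _ _ => rfl, ?_⟩
  simp only [Prog.exec, State.tick, RExp.eval, NExp.eval, h3, g4,
    hn 0 (by simp) (by simp) (by simp)]
  congr 2
  rw [hc, hr _ _ _ _ (by simp), h1 _ _ hi hj, h4 _ _ hi hj, entry_of_lt _ hi hj,
    entry_of_lt _ hi hj, entry_of_lt _ hi hj, Matrix.add_apply]

theorem exec_rateProg {s : State} {d : ℕ} {A S : Mat d} (hd : s.nat 1 = d)
    (h2 : ∀ i j, i < d → j < d → s.real 2 0 i j = entry S i j)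
    (h1 : ∀ i j, i < d → j < d → s.real 1 0 i j = entry A i j) :
    (∀ y, y ≠ 3 → y ≠ 4 → y ≠ 5 → y ≠ 7 → (rateProg.exec s).nat y = s.nat y) ∧
      (∀ i j, i < d → j < d → (rateProg.exec s).real 2 0 i j = entry S i j) ∧
      ∀ i j, i < d → j < d → (rateProg.exec s).real 1 0 i j =
        entry (A + weight (s.nat 0) d (s.nat 6) (s.nat 2) •
          base (s.nat 0) (s.nat 6) S ^ (s.nat 0 + 1)) i j := by
  obtain ⟨n₁, r₁⟩ := exec_weightProg s
  set s₁ := weightProg.exec s with hs₁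
  have hd₁ : s₁.nat 1 = d := (n₁ 1 (by simp)).trans hd
  have a₁ : ∀ a, a ≠ 3 → s₁.real a = s.real a := fun a ha => by
    rw [r₁]; funext i j k; simp [State.setReal, ha]
  have w₁ : s₁.real 3 0 0 0 = weight (s.nat 0) d (s.nat 6) (s.nat 2) := by
    rw [r₁, hd]; simp [State.setReal]
  obtain ⟨n₂, r₂⟩ := exec_initPowerProg (s := s₁) hd₁
  set s₂ := initPowerProg.exec s₁ with hs₂
  have m₂ : ∀ y, y ≠ 3 → y ≠ 4 → y ≠ 5 → s₂.nat y = s.nat y := fun y y3 y4 y5 =>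
    (n₂ y y3 y4 y5).trans (n₁ y y5)
  have a₂ : ∀ a, a ≠ 3 → a ≠ 4 → s₂.real a = s.real a := fun a ha ha' => by
    funext i j k; rw [r₂, if_neg (by simp [ha']), a₁ a ha]
  obtain ⟨n₃, r₃, p₃⟩ := exec_powerLoop (s := s₂) (d := d) (S := S)
    (c := weight (s.nat 0) d (s.nat 6) (s.nat 2))
    ((m₂ 1 (by simp) (by simp) (by simp)).trans hd)
    (fun i j hi hj => by rw [a₂ 2 (by simp) (by simp)]; exact h2 i j hi hj)
    (fun i j hi hj => by rw [r₂, if_pos ⟨rfl, rfl, hi, hj⟩, w₁])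
  set s₃ := (Prog.loop 7 (.add (.var 0) (.const 1)) mulProg).exec s₂ with hs₃
  have m₃ : ∀ y, y ≠ 3 → y ≠ 4 → y ≠ 5 → y ≠ 7 → s₃.nat y = s.nat y := fun y y3 y4 y5 y7 =>
    (n₃ y y3 y4 y5 y7).trans (m₂ y y3 y4 y5)
  have a₃ : ∀ a, a ≠ 3 → a ≠ 4 → s₃.real a = s.real a := fun a ha ha' =>
    (r₃ a ha').trans (a₂ a ha ha')
  rw [m₂ 0 (by simp) (by simp) (by simp), m₂ 6 (by simp) (by simp) (by simp)] at p₃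
  obtain ⟨n₄, r₄⟩ := exec_addProg (s := s₃) (d := d) (A := A)
    ((m₃ 1 (by simp) (by simp) (by simp) (by simp)).trans hd)
    (fun i j hi hj => by rw [a₃ 1 (by simp) (by simp)]; exact h1 i j hi hj)
    (fun i j hi hj => by
      rw [m₃ 0 (by simp) (by simp) (by simp) (by simp)]; exact p₃ i j hi hj)
  refine ⟨fun y y3 y4 y5 y7 => (n₄ y y3 y4 y5).trans (m₃ y y3 y4 y5 y7), fun i j hi hj => ?_,
    fun i j hi hj => ?_⟩
  · exact (r₄ 2 0 i j).trans (by rw [if_neg (by simp), a₃ 2 (by simp) (by simp), h2 i j hi hj])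
  · exact (r₄ 1 0 i j).trans (by rw [if_pos ⟨rfl, rfl, hi, hj⟩])

/-- The program computes the strategy, whatever the coins. -/
theorem predict_strategyProg (n : ℕ) {d : ℕ} (Ys : List (Mat d)) (coins : ℕ → Bool) :
    predict strategyProg n Ys coins = strategy n Ys := by
  set s := initState n Ys coins with hs
  obtain ⟨n₁, r₁⟩ := exec_lossSumProg (s := s) (d := d) (Ys := Ys) (by simp [hs, initState])
    (by simp [hs, initState]) (by simp [hs, initState])
    (fun l i j hi hj => by simp [hs, initState, hi, hj, entry])
  set s₁ := lossSumProg.exec s with hs₁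
  have m0 : s₁.nat 0 = n := (n₁ 0 (by simp) (by simp) (by simp)).trans (by simp [hs, initState])
  have m1 : s₁.nat 1 = d := (n₁ 1 (by simp) (by simp) (by simp)).trans (by simp [hs, initState])
  have m2 : s₁.nat 2 = Ys.length :=
    (n₁ 2 (by simp) (by simp) (by simp)).trans (by simp [hs, initState])
  have key := exec_loop_induct (fun k s' =>
    (∀ y < 3, s'.nat y = s₁.nat y) ∧
      (∀ i j, i < d → j < d → s'.real 2 0 i j = entry (lossSum Ys) i j) ∧
      ∀ i j, i < d → j < d → s'.real 1 0 i j =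
        entry (∑ k ∈ Finset.range k,
          weight n d k Ys.length • base n k (lossSum Ys) ^ (n + 1)) i j)
    6 (.var 0) rateProg s₁ ?_ ?_
  · funext i j
    have h := key.2.2 i j i.2 j.2
    simp only [NExp.eval, m0] at h
    rw [entry_of_lt _ i.2 j.2] at h
    exact h
  · refine ⟨fun _ _ => rfl, fun i j hi hj => ?_, fun i j hi hj => ?_⟩
    · exact (r₁ 2 0 i j).trans (if_pos ⟨rfl, rfl, hi, hj⟩)
    · refine (r₁ 1 0 i j).trans ?_
      rw [if_neg (by simp), entry_of_lt _ hi hj]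
      simp [hs, initState]
  · rintro k - s₂ ⟨hn, h2, h1⟩
    set s₃ := (s₂.setNat 6 k).tick 1 with hs₃
    have hn₃ : ∀ y < 3, s₃.nat y = s₁.nat y := fun y hy => by
      simp [hs₃, State.tick, State.setNat, show y ≠ 6 by omega, hn y hy]
    obtain ⟨g, g2, g1⟩ := exec_rateProg (s := s₃) (d := d) (S := lossSum Ys)
      ((hn₃ 1 (by simp)).trans m1) h2 h1
    refine ⟨fun y hy => ?_, g2, fun i j hi hj => ?_⟩
    · rw [g y (by omega) (by omega) (by omega) (by omega), hn₃ y hy]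
    · rw [g1 i j hi hj, hn₃ 0 (by simp), hn₃ 2 (by simp), m0, m2,
        show s₃.nat 6 = k by simp [hs₃, State.tick, State.setNat], Finset.sum_range_succ]

end Strategy

/-! ### The regret of the strategy -/

section Regret

variable {d : ℕ}

theorem posSemidef_smul_one_sub_sum {H : ℕ → Mat d} (hH : ∀ t, (1 - H t).PosSemidef) {n t : ℕ}
    (ht : t ≤ n) : ((n : ℝ) • (1 : Mat d) - ∑ s ∈ Finset.range t, H s).PosSemidef := by
  have h1 : (∑ s ∈ Finset.range t, (1 - H s)).PosSemidef := posSemidef_sum _ fun s _ => hH s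
  have h2 : (((n : ℝ) - t) • (1 : Mat d)).PosSemidef :=
    PosSemidef.one.smul (sub_nonneg.mpr (by exact_mod_cast ht))
  convert h2.add h1 using 1
  rw [Finset.sum_sub_distrib, Finset.sum_const, Finset.card_range, sub_smul, Nat.cast_smul_eq_nsmul,
    Nat.cast_smul_eq_nsmul]
  abel

theorem rate_pos {n : ℕ} (hn : 1 ≤ n) (k : ℕ) : 0 < rate n k := by
  have : (0 : ℝ) < n := by exact_mod_cast hn
  unfold rate
  push_cast
  positivity

theorem rate_le_half {n k : ℕ} (hk : k < n) : rate n k ≤ 1 / 2 := by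
  have h0 : (0 : ℝ) < n := by exact_mod_cast (show 0 < n by omega)
  have h1 : (k : ℝ) + 1 ≤ n := by exact_mod_cast hk
  unfold rate
  push_cast
  rw [div_le_div_iff₀ (by positivity) (by positivity)]
  linarith

theorem corr_nonneg (n k : ℕ) : 0 ≤ corr n k := by
  unfold corr
  nlinarith [mul_self_nonneg (rate n k)]

theorem corr_le_half {n k : ℕ} (hk : k < n) : corr n k ≤ 1 / 2 := by
  have h1 := rate_le_half hk
  have h2 := rate_pos (show 1 ≤ n by omega) k
  unfold corr
  nlinarith

theorem weight_nonneg {n k : ℕ} (hk : k < n) (d t : ℕ) : 0 ≤ weight n d k t := by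
  have h1 := rate_pos (show 1 ≤ n by omega) k
  have h2 := corr_nonneg n k
  have h3 := corr_le_half hk
  have h4 : 0 ≤ 1 - corr n k := by linarith
  unfold weight
  positivity

theorem base_ge_half {n k : ℕ} (hk : k < n) {S : Mat d}
    (hS : ((n : ℝ) • (1 : Mat d) - S).PosSemidef) :
    (base n k S - (1 / 2 : ℝ) • (1 : Mat d)).PosSemidef := by
  have h0 : (0 : ℝ) < n := by exact_mod_cast (show 0 < n by omega)
  set b : ℝ := rate n k / ((n + 2 : ℕ) : ℝ) with hb
  have hb0 : 0 ≤ b := div_nonneg (rate_pos (by omega) k).le (Nat.cast_nonneg _)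
  have hbn : b * n ≤ 1 / 2 := by
    have h1 := rate_le_half hk
    rw [hb, div_mul_eq_mul_div, div_le_iff₀ (by positivity)]
    push_cast
    nlinarith
  have h2 := (hS.smul hb0).add
    (PosSemidef.one.smul (show (0 : ℝ) ≤ 1 / 2 - b * n by linarith) :
      ((_ : ℝ) • (1 : Mat d)).PosSemidef)
  convert h2 using 1
  rw [base, ← hb, smul_sub, smul_smul, sub_smul]
  have : (1 : Mat d) = (1 / 2 : ℝ) • (1 : Mat d) + (1 / 2 : ℝ) • (1 : Mat d) := by
    rw [← add_smul]; norm_num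
  nth_rewrite 1 [this]
  abel

theorem strategy_posSemidef_of_lossSum {n : ℕ} {Ys : List (Mat d)}
    (hS : ((n : ℝ) • (1 : Mat d) - lossSum Ys).PosSemidef) : (strategy n Ys).PosSemidef := by
  refine posSemidef_sum _ fun k hk => ?_
  have hk := Finset.mem_range.mp hk
  exact ((posSemidef_of_sub_smul_one (by norm_num) (base_ge_half hk hS)).pow _).smul
    (weight_nonneg hk _ _)

theorem posSemidef_one_sub_symPart {Y : Mat d} (hY : specNorm Y ≤ 1) :
    (1 - symPart Y).PosSemidef :=
  posSemidef_one_sub (symPart_transpose Y)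
    (posSemidef_one_sub_sq (symPart_transpose Y) (specNorm_symPart_le hY))

theorem posSemidef_one_add_symPart {Y : Mat d} (hY : specNorm Y ≤ 1) :
    (1 - -symPart Y).PosSemidef :=
  posSemidef_one_sub (by rw [transpose_neg, symPart_transpose])
    (by simpa using posSemidef_one_sub_sq (symPart_transpose Y) (specNorm_symPart_le hY))

theorem strategy_posSemidef {n : ℕ} {Ys : List (Mat d)} (hlen : Ys.length ≤ n)
    (hY : ∀ Y ∈ Ys, specNorm Y ≤ 1) : (strategy n Ys).PosSemidef := by
  refine strategy_posSemidef_of_lossSum (posSemidef_smul_one_sub_sum (fun t => ?_) hlen)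
  refine posSemidef_one_sub_symPart ?_
  by_cases ht : t < Ys.length
  · rw [List.getD_eq_getElem _ _ ht]
    exact hY _ (List.getElem_mem ht)
  · rw [List.getD_eq_default _ _ (by omega)]
    simp [specNorm]

theorem lossSum_map_range (Y : ℕ → Mat d) (t : ℕ) :
    lossSum ((List.range t).map Y) = ∑ s ∈ Finset.range t, symPart (Y s) := by
  rw [lossSum, List.length_map, List.length_range]
  refine Finset.sum_congr rfl fun s hs => ?_
  rw [List.getD_eq_getElem _ _ (by simpa using Finset.mem_range.mp hs)]
  simp

/-- The potential of one betting rate pays for the loss of its share of the play. -/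
theorem sum_le_potential_drop {n k : ℕ} (hk : k < n) {H : ℕ → Mat d} (hs : ∀ t, (H t)ᵀ = H t)
    (hH : ∀ t, (1 - H t * H t).PosSemidef) {t : ℕ} (ht : t ≤ n) :
    ∑ s ∈ Finset.range t, rate n k / (1 + corr n k) * ((1 - corr n k) / (1 + corr n k)) ^ s *
        (base n k (∑ r ∈ Finset.range s, H r) ^ (n + 1) * H s).trace ≤
      d - ((1 - corr n k) / (1 + corr n k)) ^ t *
        (base n k (∑ r ∈ Finset.range t, H r) ^ (n + 2)).trace := by
  induction t with
  | zero => simp [base]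
  | succ t ih =>
    rw [Finset.sum_range_succ]
    have ih := ih (by omega)
    have hH' : ∀ t, (1 - H t).PosSemidef := fun t => posSemidef_one_sub (hs t) (hH t)
    have hA := base_ge_half hk (posSemidef_smul_one_sub_sum hH' (show t ≤ n by omega))
    have hA' := base_ge_half hk (posSemidef_smul_one_sub_sum hH' ht)
    have hstep : base n k (∑ r ∈ Finset.range (t + 1), H r) =
        base n k (∑ r ∈ Finset.range t, H r) - (rate n k / ((n + 2 : ℕ) : ℝ)) • H t := by
      rw [base, base, Finset.sum_range_succ, smul_add]
      abel
    have hb0 : 0 ≤ rate n k / ((n + 2 : ℕ) : ℝ) :=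
      div_nonneg (rate_pos (by omega) k).le (Nat.cast_nonneg _)
    rw [hstep] at hA' ⊢
    have key := potential_step hb0 (show 1 ≤ n by omega) hA hA' (hs t) (hH t)
    have hβ : rate n k / ((n + 2 : ℕ) : ℝ) * ((n : ℝ) + 2) = rate n k := by
      push_cast
      field_simp
    have hu : 2 * rate n k ^ 2 = corr n k := by rw [corr]; ring
    rw [hβ, hu] at key
    have hu0 := corr_nonneg n k
    have hu1 := corr_le_half hk
    set u := corr n k
    set T := (base n k (∑ r ∈ Finset.range t, H r) ^ (n + 2)).trace
    set T' := ((base n k (∑ r ∈ Finset.range t, H r) - (rate n k / ((n + 2 : ℕ) : ℝ)) • H t) ^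
      (n + 2)).trace
    set X := (base n k (∑ r ∈ Finset.range t, H r) ^ (n + 1) * H t).trace
    have hr : 0 ≤ ((1 - u) / (1 + u)) ^ t :=
      pow_nonneg (div_nonneg (by linarith) (by linarith)) _
    have h1 : (1 - u) / (1 + u) * T' ≤ T - rate n k / (1 + u) * X := by
      have h0 : 0 < 1 + u := by linarith
      rw [div_mul_eq_mul_div, div_mul_eq_mul_div, div_le_iff₀ h0, sub_mul T, div_mul_cancel₀ _ h0.ne']
      linarith
    have h2 := mul_le_mul_of_nonneg_left h1 hr
    rw [pow_succ]
    linarith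

/-- The potential of each rate is `d` at the start. -/
theorem strategy_loss_le {n : ℕ} {Y : ℕ → Mat d} (hY : ∀ t, specNorm (Y t) ≤ 1) :
    ∑ t ∈ Finset.range n, matInner (strategy n ((List.range t).map Y)) (Y t) ≤
      ∑ k ∈ Finset.range n, ((n - 1 : ℕ) : ℝ) / ((n * n * d : ℕ) : ℝ) *
        (d - ((1 - corr n k) / (1 + corr n k)) ^ n *
          (base n k (∑ r ∈ Finset.range n, symPart (Y r)) ^ (n + 2)).trace) := by
  have h1 : ∀ t ∈ Finset.range n, matInner (strategy n ((List.range t).map Y)) (Y t) =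
      ∑ k ∈ Finset.range n, ((n - 1 : ℕ) : ℝ) / ((n * n * d : ℕ) : ℝ) *
        (rate n k / (1 + corr n k) * ((1 - corr n k) / (1 + corr n k)) ^ t *
        (base n k (∑ r ∈ Finset.range t, symPart (Y r)) ^ (n + 1) * symPart (Y t)).trace) := by
    intro t ht
    have hp : (strategy n ((List.range t).map Y)).PosSemidef := by
      refine strategy_posSemidef ?_ ?_
      · simpa using (Finset.mem_range.mp ht).le
      · intro Z hZ
        obtain ⟨s, -, rfl⟩ := List.mem_map.mp hZ
        exact hY s
    have hsym := hp.isHermitian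
    rw [IsHermitian, conjTranspose_eq_transpose_of_trivial] at hsym
    rw [matInner_eq_trace_symPart hsym, strategy, lossSum_map_range, Finset.sum_mul, trace_sum]
    refine Finset.sum_congr rfl fun k _ => ?_
    rw [Matrix.smul_mul, trace_smul, smul_eq_mul, weight, List.length_map, List.length_range]
    ring
  rw [Finset.sum_congr rfl h1, Finset.sum_comm]
  refine Finset.sum_le_sum fun k hk => ?_
  rw [← Finset.mul_sum]
  refine mul_le_mul_of_nonneg_left ?_ (by positivity)
  exact sum_le_potential_drop (Finset.mem_range.mp hk) (fun t => symPart_transpose _)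
    (fun t => posSemidef_one_sub_sq (symPart_transpose _) (specNorm_symPart_le (hY t))) le_rfl

theorem one_sub_ge_exp {u : ℝ} (h0 : 0 ≤ u) (h1 : u ≤ 1 / 2) : Real.exp (-(2 * u)) ≤ 1 - u := by
  have h2 : 0 < 1 - u := by linarith
  have h := Real.one_sub_inv_le_log_of_pos h2
  rw [← Real.le_log_iff_exp_le h2]
  refine le_trans ?_ h
  have : (1 - u)⁻¹ ≤ 1 + 2 * u := by
    rw [inv_le_iff_one_le_mul₀ h2]
    nlinarith
  linarith

theorem exp_sub_sq_le_one_add {x : ℝ} (h0 : 0 ≤ x) : Real.exp (x - x ^ 2) ≤ 1 + x := by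
  have h2 : 0 < 1 + x := by linarith
  rw [← Real.le_log_iff_exp_le h2]
  refine le_trans ?_ (Real.one_sub_inv_le_log_of_pos h2)
  rw [le_sub_iff_add_le, ← le_sub_iff_add_le', inv_le_iff_one_le_mul₀ h2]
  nlinarith [pow_nonneg h0 3]

/-- Lower bound for the final potential when `-S` has an eigenvalue `G`. -/
theorem exp_le_final_potential {n k : ℕ} (hk : k < n) {G : ℝ} (hG : 0 ≤ G) (hGn : G ≤ n) :
    Real.exp (rate n k * G - 7 * n * rate n k ^ 2) ≤
      ((1 - corr n k) / (1 + corr n k)) ^ n *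
        (1 + rate n k / ((n + 2 : ℕ) : ℝ) * G) ^ (n + 2) := by
  have hu0 := corr_nonneg n k
  have hu1 := corr_le_half hk
  have hβ := rate_pos (show 1 ≤ n by omega) k
  have hu : corr n k = 2 * rate n k ^ 2 := by rw [corr]; ring
  set β := rate n k with hβd
  set u := corr n k
  have hn : (0 : ℝ) < ((n + 2 : ℕ) : ℝ) := by positivity
  set x := β / ((n + 2 : ℕ) : ℝ) * G with hx
  have hx0 : 0 ≤ x := by positivity
  have h1 : Real.exp (-(3 * u)) ≤ (1 - u) / (1 + u) := by
    rw [le_div_iff₀ (by linarith)]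
    have h2 := one_sub_ge_exp hu0 hu1
    have h3 : 1 + u ≤ Real.exp u := by linarith [Real.add_one_le_exp u]
    calc Real.exp (-(3 * u)) * (1 + u) ≤ Real.exp (-(3 * u)) * Real.exp u := by gcongr
      _ = Real.exp (-(2 * u)) := by rw [← Real.exp_add]; ring_nf
      _ ≤ _ := h2
  have h2 := pow_le_pow_left₀ (Real.exp_pos _).le h1 n
  have h3 := pow_le_pow_left₀ (Real.exp_pos _).le (exp_sub_sq_le_one_add hx0) (n + 2)
  rw [← Real.exp_nat_mul] at h2 h3
  refine le_trans ?_ (mul_le_mul h2 h3 (Real.exp_pos _).le ((Real.exp_pos _).le.trans h2))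
  rw [← Real.exp_add]
  refine Real.exp_le_exp.mpr ?_
  have e1 : ((n + 2 : ℕ) : ℝ) * x = β * G := by
    rw [hx]; field_simp
  have e2 : ((n + 2 : ℕ) : ℝ) * x ^ 2 ≤ n * β ^ 2 := by
    have hxb : x ≤ β := by
      rw [hx, div_mul_eq_mul_div, div_le_iff₀ hn]
      push_cast
      nlinarith
    calc ((n + 2 : ℕ) : ℝ) * x ^ 2 = (((n + 2 : ℕ) : ℝ) * x) * x := by ring
      _ = β * G * x := by rw [e1]
      _ ≤ β * n * β := by gcongr
      _ = _ := by ring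
  rw [mul_sub, e1, hu]
  nlinarith

/-- Among the betting rates, one is within a factor `2` of the best one for the eigenvalue `G`. -/
theorem exists_good_rate {n : ℕ} {G : ℝ} (hG : 7 ≤ G) (hGn : G ≤ n) :
    ∃ k < n, G ^ 2 / (56 * n) ≤ rate n k * G - 7 * n * rate n k ^ 2 := by
  have hn : (0 : ℝ) < n := by linarith
  set m := ⌊G / 7⌋₊ with hm
  have h1 : (m : ℝ) ≤ G / 7 := Nat.floor_le (by linarith)
  have h2 : G / 7 < m + 1 := Nat.lt_floor_add_one _
  have h3 : 1 ≤ m := Nat.le_floor (by rw [Nat.cast_one]; linarith)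
  have h3' : (1 : ℝ) ≤ m := by exact_mod_cast h3
  have h4 : m ≤ n := by
    have : (m : ℝ) ≤ n := by linarith
    exact_mod_cast this
  refine ⟨m - 1, by omega, ?_⟩
  have e : rate n (m - 1) = m / (2 * n) := by
    rw [rate, Nat.sub_add_cancel h3]
    push_cast
    rfl
  have e2 : rate n (m - 1) * G - 7 * n * rate n (m - 1) ^ 2 =
      (14 * m * (2 * G - 7 * m)) / (56 * n) := by
    rw [e]; field_simp; ring
  rw [e2]
  gcongr
  nlinarith

theorem half_le_log {x : ℝ} (hx : 2 ≤ x) : 1 / 2 ≤ Real.log x := by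
  have := Real.log_two_gt_d9
  have := Real.log_le_log (by norm_num) hx
  linarith

/-- Optimization of the regret bound over the unknown eigenvalue `G`: either the exponential
dominates `w G`, or `G` is at most of the order of the square root. -/
theorem regret_optimization {n d : ℕ} (hn : 2 ≤ n) (hd : 2 ≤ d) {w G R : ℝ} (hw : 0 ≤ w)
    (hGn : G ≤ n) (hR : R ≤ 1 + w * G)
    (hR' : 7 ≤ G → R ≤ 1 + w * G -
      ((n - 1 : ℕ) : ℝ) / ((n * n * d : ℕ) : ℝ) * Real.exp (G ^ 2 / (56 * n))) :
    R ≤ 22 * ((w + 1) * Real.sqrt (n * Real.log d * Real.log ((w + 1) * n))) := by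
  have hn' : (2 : ℝ) ≤ n := by exact_mod_cast hn
  have hd' : (2 : ℝ) ≤ d := by exact_mod_cast hd
  have hx : 2 ≤ (w + 1) * n := by nlinarith
  have ha := half_le_log hd'
  have hl := half_le_log hx
  set a := Real.log d with ha'
  set l := Real.log ((w + 1) * n) with hl'
  have hal : 1 / 4 ≤ a * l := by nlinarith
  have hnal : 1 / 2 ≤ n * a * l := by nlinarith
  set q := Real.sqrt (n * a * l) with hq
  have hq1 : 1 / 2 ≤ q := Real.le_sqrt_of_sq_le (by linarith)
  have hwq : 0 ≤ w * (q - 1 / 2) := mul_nonneg hw (by linarith)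
  rcases lt_or_ge G 7 with hG | hG
  · nlinarith
  have hR' := hR' hG
  have hn0 : (0 : ℝ) < n := by linarith
  have hd0 : (0 : ℝ) < d := by linarith
  rcases le_or_gt (w * G) (((n - 1 : ℕ) : ℝ) / ((n * n * d : ℕ) : ℝ) *
    Real.exp (G ^ 2 / (56 * n))) with h | h
  · nlinarith
  have hε : 1 / (2 * n * d) ≤ ((n - 1 : ℕ) : ℝ) / ((n * n * d : ℕ) : ℝ) := by
    rw [Nat.cast_sub (by omega)]
    push_cast
    rw [div_le_div_iff₀ (by positivity) (by positivity)]
    have : 0 ≤ (n * d : ℝ) * (n - 2) := mul_nonneg (by positivity) (by linarith)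
    nlinarith
  have h1 : 1 / (2 * n * d) * Real.exp (G ^ 2 / (56 * n)) < w * G :=
    lt_of_le_of_lt (by gcongr) h
  rw [div_mul_eq_mul_div, one_mul, div_lt_iff₀ (by positivity)] at h1
  have h2 : Real.exp (G ^ 2 / (56 * n)) ≤ d * ((w + 1) * n) ^ 3 := by
    refine h1.le.trans ?_
    calc w * G * (2 * n * d) ≤ w * n * (2 * n * d) := by gcongr
      _ = d * (2 * (w * n ^ 2)) := by ring
      _ ≤ d * (((w + 1) * n) * ((w + 1) * n) ^ 2) := by
          gcongr
          rw [mul_pow]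
          gcongr
          nlinarith
      _ = _ := by ring
  have h3 : G ^ 2 / (56 * n) ≤ a + 3 * l := by
    have := Real.log_le_log (Real.exp_pos _) h2
    rwa [Real.log_exp, Real.log_mul hd0.ne' (by positivity), Real.log_pow] at this
  -- Both logarithms are at least `1 / 2`, so their sum is at most a multiple of their product.
  have h4 : a + 3 * l ≤ 8 * (a * l) := by nlinarith
  have h5 : G ^ 2 ≤ 448 * (n * a * l) := by
    rw [div_le_iff₀ (by positivity)] at h3
    nlinarith
  have hq2 : q ^ 2 = n * a * l := Real.sq_sqrt (by linarith)
  have h6 : G ≤ 22 * q := by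
    refine le_of_sq_le_sq ?_ (by linarith)
    nlinarith
  have h7 : w * G ≤ w * (22 * q) := by gcongr
  nlinarith

/-- The case of a single round, in which the play is zero. -/
theorem strategy_regret_one {Y W : Mat d} (hd : 2 ≤ d) (hY : specNorm Y ≤ 1)
    (hW : W.PosSemidef) :
    -matInner W Y ≤ 22 * ((traceNorm W + 1) *
      Real.sqrt ((1 : ℕ) * Real.log d * Real.log ((traceNorm W + 1) * (1 : ℕ)))) := by
  have hsym := hW.isHermitian
  rw [IsHermitian, conjTranspose_eq_transpose_of_trivial] at hsym
  have h1 := trace_mul_nonneg_of_posSemidef hW (posSemidef_one_add_symPart hY)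
  rw [sub_neg_eq_add, Matrix.mul_add, Matrix.mul_one, trace_add,
    ← matInner_eq_trace_symPart hsym] at h1
  have h2 := trace_le_traceNorm W
  have h3 := hW.trace_nonneg
  set w := traceNorm W
  have hw : 0 ≤ w := h3.trans h2
  have hd' : (2 : ℝ) ≤ d := by exact_mod_cast hd
  have ha := half_le_log hd'
  rw [Nat.cast_one, one_mul, mul_one]
  have hw1 : 0 < w + 1 := by linarith
  have hl : w / (w + 1) ≤ Real.log (w + 1) := by
    refine le_trans (le_of_eq ?_) (Real.one_sub_inv_le_log_of_pos hw1)
    field_simp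
    ring
  have hz0 : 0 ≤ w / (w + 1) := by positivity
  have hz1 : w / (w + 1) ≤ 1 := by rw [div_le_one hw1]; linarith
  have hs : w / (w + 1) / 2 ≤ Real.sqrt (Real.log d * Real.log (w + 1)) := by
    refine Real.le_sqrt_of_sq_le ?_
    nlinarith
  have h4 : w / (w + 1) * (w + 1) = w := by field_simp
  nlinarith

/-- The regret bound against an arbitrary sequence of losses. -/
theorem strategy_regret_le {n : ℕ} (hn : 1 ≤ n) (hd : 2 ≤ d) {Y : ℕ → Mat d}
    (hY : ∀ t, specNorm (Y t) ≤ 1) {W : Mat d} (hW : W.PosSemidef) :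
    ∑ t ∈ Finset.range n, matInner (strategy n ((List.range t).map Y)) (Y t) -
        ∑ t ∈ Finset.range n, matInner W (Y t) ≤
      22 * ((traceNorm W + 1) *
        Real.sqrt (n * Real.log d * Real.log ((traceNorm W + 1) * n))) := by
  have hloss := strategy_loss_le (n := n) hY
  rcases Nat.lt_or_ge n 2 with h | hn2
  · obtain rfl : n = 1 := by omega
    refine le_trans ?_ (strategy_regret_one hd (hY 0) hW)
    simpa using hloss
  have : Nonempty (Fin d) := ⟨⟨0, by omega⟩⟩
  set S := ∑ r ∈ Finset.range n, symPart (Y r) with hS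
  obtain ⟨G, hGn, hGW, hGp⟩ := exists_extreme_eigenvalue (S := S) (N := n)
    (by
      have := posSemidef_smul_one_sub_sum (fun t => posSemidef_one_add_symPart (hY t)) (le_refl n)
      rwa [Finset.sum_neg_distrib, sub_neg_eq_add] at this)
    (posSemidef_smul_one_sub_sum (fun t => posSemidef_one_sub_symPart (hY t)) (le_refl n))
  have hsym := hW.isHermitian
  rw [IsHermitian, conjTranspose_eq_transpose_of_trivial] at hsym
  have hcomp : ∑ t ∈ Finset.range n, matInner W (Y t) = (W * S).trace := by
    rw [hS, Finset.mul_sum, trace_sum]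
    exact Finset.sum_congr rfl fun t _ => matInner_eq_trace_symPart hsym _
  have hn0 : (0 : ℝ) < n := by exact_mod_cast hn
  have hd0 : (0 : ℝ) < d := by exact_mod_cast (show 0 < d by omega)
  set ε := ((n - 1 : ℕ) : ℝ) / ((n * n * d : ℕ) : ℝ) with hε
  have hε0 : 0 ≤ ε := by positivity
  set Φ : ℕ → ℝ := fun k => ((1 - corr n k) / (1 + corr n k)) ^ n *
    (base n k S ^ (n + 2)).trace with hΦ
  have hΦ0 : ∀ k ∈ Finset.range n, 0 ≤ Φ k := fun k hk => by
    have hk := Finset.mem_range.mp hk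
    have h1 := corr_nonneg n k
    have h2 := corr_le_half hk
    refine mul_nonneg (pow_nonneg (div_nonneg (by linarith) (by linarith)) _) ?_
    exact ((posSemidef_of_sub_smul_one (by norm_num) (base_ge_half hk
      (posSemidef_smul_one_sub_sum (fun t => posSemidef_one_sub_symPart (hY t))
        (le_refl n)))).pow _).trace_nonneg
  have hεd : n * (ε * d) ≤ 1 := by
    have : n * (ε * d) = ((n - 1 : ℕ) : ℝ) / n := by
      rw [hε]; push_cast; field_simp
    rw [this, div_le_one hn0]
    exact_mod_cast Nat.sub_le n 1
  have hloss' : ∑ t ∈ Finset.range n, matInner (strategy n ((List.range t).map Y)) (Y t) ≤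
      1 - ε * ∑ k ∈ Finset.range n, Φ k := by
    refine hloss.trans ?_
    rw [← Finset.mul_sum, Finset.sum_sub_distrib, Finset.sum_const, Finset.card_range, nsmul_eq_mul]
    have : ε * (n * (d : ℝ)) = n * (ε * d) := by ring
    linarith
  have htr := trace_le_traceNorm W
  have htr0 := hW.trace_nonneg
  have hsum0 := Finset.sum_nonneg hΦ0
  have hw0 : 0 ≤ traceNorm W := htr0.trans htr
  have hGW := hGW W hW
  rw [hcomp]
  -- `-S` may have only negative eigenvalues; then `max G 0` still bounds the comparator term.
  have hGG : G * W.trace ≤ traceNorm W * max G 0 := by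
    calc G * W.trace ≤ max G 0 * W.trace := by gcongr; exact le_max_left _ _
      _ ≤ max G 0 * traceNorm W := by gcongr
      _ = _ := mul_comm _ _
  refine regret_optimization (G := max G 0) hn2 hd hw0 (max_le hGn hn0.le) ?_ fun h7 => ?_
  · have := mul_nonneg hε0 hsum0
    linarith
  · have hG0 : 7 ≤ G := by
      rcases le_max_iff.mp h7 with h | h
      · exact h
      · norm_num at h
    rw [max_eq_left (by linarith : (0 : ℝ) ≤ G)] at hGG ⊢
    obtain ⟨k, hk, hkG⟩ := exists_good_rate hG0 hGn
    have hb0 : 0 ≤ rate n k / ((n + 2 : ℕ) : ℝ) :=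
      div_nonneg (rate_pos hn k).le (Nat.cast_nonneg _)
    have hbn : rate n k / ((n + 2 : ℕ) : ℝ) * n ≤ 1 := by
      have h1 := rate_le_half hk
      rw [div_mul_eq_mul_div, div_le_one (by positivity)]
      push_cast
      nlinarith
    have h1 := exp_le_final_potential hk (by linarith : (0 : ℝ) ≤ G) hGn
    have h2 : Real.exp (G ^ 2 / (56 * n)) ≤ Φ k := by
      refine (Real.exp_le_exp.mpr hkG).trans (h1.trans ?_)
      refine mul_le_mul_of_nonneg_left (hGp _ (n + 2) hb0 hbn) ?_
      have := corr_nonneg n k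
      have := corr_le_half hk
      exact pow_nonneg (div_nonneg (by linarith) (by linarith)) _
    have h3 := Finset.single_le_sum hΦ0 (Finset.mem_range.mpr hk)
    have h4 := mul_le_mul_of_nonneg_left (h2.trans h3) hε0
    linarith

end Regret

/-! ### The game -/

section Game

variable {d : ℕ}

theorem transcript_losses (P : Prog) (n : ℕ) (nature : List (Mat d) → Mat d)
    (ω : ℕ → ℕ → Bool) (t : ℕ) :
    (transcript P n nature ω t).2 = (List.range t).map (loss P n nature ω) := by
  induction t with
  | zero => rfl
  | succ t ih =>
    rw [List.range_succ, List.map_append, ← ih]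
    rfl

/-- Since the program ignores its coins, the course of the game does not depend on them. -/
theorem transcript_strategyProg (n : ℕ) (nature : List (Mat d) → Mat d) (ω ω' : ℕ → ℕ → Bool)
    (t : ℕ) :
    transcript strategyProg n nature ω t = transcript strategyProg n nature ω' t := by
  induction t with
  | zero => rfl
  | succ t ih => simp only [transcript, ih, predict_strategyProg]

theorem regret_strategyProg (n : ℕ) (nature : List (Mat d) → Mat d) (W : Mat d)
    (ω ω' : ℕ → ℕ → Bool) :
    regret strategyProg n nature W ω = regret strategyProg n nature W ω' := by
  simp only [regret, play, loss, predict_strategyProg, transcript_strategyProg n nature ω ω']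

theorem regret_strategyProg_le {n : ℕ} (hn : 1 ≤ n) (hd : 2 ≤ d)
    {nature : List (Mat d) → Mat d} (hnat : ∀ Ws, specNorm (nature Ws) ≤ 1) {W : Mat d}
    (hW : W.PosSemidef) (ω : ℕ → ℕ → Bool) :
    regret strategyProg n nature W ω ≤ 22 * ((traceNorm W + 1) *
      Real.sqrt (n * Real.log d * Real.log ((traceNorm W + 1) * n))) := by
  have h := strategy_regret_le hn hd (Y := loss strategyProg n nature ω) (fun t => hnat _) hW
  simpa only [regret, play, predict_strategyProg, transcript_losses] using h

instance : MeasureTheory.IsProbabilityMeasure coinLaw := by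
  unfold coinLaw
  infer_instance

end Game

end OnlineMatrix

theorem theorem6 :
    ∃ (P : OnlineMatrix.Prog) (c k : ℕ) (C : ℝ), 0 < C ∧
      ∀ n d : ℕ, 1 ≤ n → 2 ≤ d →
        (∀ (Ys : List (OnlineMatrix.Mat d)) (coins : ℕ → Bool), Ys.length < n →
          (∀ Y ∈ Ys, OnlineMatrix.specNorm Y ≤ 1) →
            OnlineMatrix.steps P n Ys coins ≤ c * (n + d) ^ k ∧
            (OnlineMatrix.predict P n Ys coins).PosSemidef) ∧
        (∀ nature : List (OnlineMatrix.Mat d) → OnlineMatrix.Mat d,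
          (∀ Ws, OnlineMatrix.specNorm (nature Ws) ≤ 1) →
          ∀ W : OnlineMatrix.Mat d, W.PosSemidef →
            MeasureTheory.Integrable (OnlineMatrix.regret P n nature W) OnlineMatrix.coinLaw ∧
            ∫ ω, OnlineMatrix.regret P n nature W ω ∂OnlineMatrix.coinLaw ≤
              C * ((OnlineMatrix.traceNorm W + 1) *
                Real.sqrt (n * Real.log d * Real.log ((OnlineMatrix.traceNorm W + 1) * n)))) := by
  obtain ⟨c, k, hck⟩ := OnlineMatrix.exists_timeBound_le OnlineMatrix.strategyProg
  refine ⟨OnlineMatrix.strategyProg, c, k, 22, by norm_num, fun n d hn hd => ⟨?_, ?_⟩⟩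
  · intro Ys coins hlen hY
    refine ⟨?_, ?_⟩
    · have h := (OnlineMatrix.exec_time_le (N := n + d) OnlineMatrix.strategyProg
        OnlineMatrix.strategyProg_safe (OnlineMatrix.initState n Ys coins)
        (by simp [OnlineMatrix.initState]; omega) (by simp [OnlineMatrix.initState])
        (by simp [OnlineMatrix.initState]; omega)).2
      have h0 : (OnlineMatrix.initState n Ys coins).time = 0 := rfl
      rw [h0, zero_add] at h
      exact h.trans (hck _ (by omega))
    · rw [OnlineMatrix.predict_strategyProg]
      exact OnlineMatrix.strategy_posSemidef hlen.le hY
  · intro nature hnat W hW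
    have hc : OnlineMatrix.regret OnlineMatrix.strategyProg n nature W =
        fun _ => OnlineMatrix.regret OnlineMatrix.strategyProg n nature W fun _ _ => false :=
      funext fun ω => OnlineMatrix.regret_strategyProg n nature W ω _
    rw [hc]
    refine ⟨MeasureTheory.integrable_const _, ?_⟩
    rw [MeasureTheory.integral_const, MeasureTheory.probReal_univ, one_smul]
    exact OnlineMatrix.regret_strategyProg_le hn hd hnat hW _
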